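/- Work in ZFC, with $V$ the universe of sets. An inner model is a transitive class containing all ordinals and satisfying ZFC. Let $P$ be an inner model. A $P$-ultrafilter on a set $X\in P$ is an ultrafilter $U$ on the Boolean algebra $P(X)\cap P$ ($U$ itself need not belong to $P$). When the ultrapower of $P$ by $U$, formed with the functions $f\in P$ with domain $X$, is well-founded, $M_U^P$ denotes its transitive collapse and $j_U^P:P\to M_U^P$ the canonical embedding, which sends $a$ to the class of the constant function with value $a$. An elementary embedding $i:P\to Q$ of inner models is an ultrapower embedding of $P$ if $i=j_U^P$ for some $P$-ultrafilter $U$, and an internal ultrapower embedding of $P$ if $i=j_U^P$ for some $P$-ultrafilter $U\in P$. A comparison of two ultrapower embeddings $j_0:V\to M_0$ and $j_1:V\to M_1$ is a pair of elementary embeddings $i_0:M_0\to N$, $i_1:M_1\to N$ into a common inner model $N$ such that $i_0\circ j_0=i_1\circ j_1$, $i_0$ is an internal ultrapower embedding of $M_0$, and $i_1$ is an internal ultrapower embedding of $M_1$. The Ultrapower Axiom (UA) states that every pair of ultrapower embeddings of $V$ admits a comparison. **Proposition.** Assume UA. Let $\lambda$ be an infinite cardinal, and let $M$ be an ultrapower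 of the universe (that is, there is an ultrapower embedding $j:V\to M$) such that $M^\lambda\subseteq M$, i.e. every function from $\lambda$ to $M$ belongs to $M$. Then every countably complete ultrafilter $D$ on an ordinal $\gamma<\lambda$ belongs to $M$. -/

import Mathlib

open FirstOrder Cardinal

universe u

namespace UltrapowerAxiom

/-! The universe `V` of sets is Mathlib's `ZFSet.{u}`; a class is a `Set ZFSet.{u}`, and the elements
of a class `P` form the type `↥P`. -/

/-- The universe of sets, as a class. -/
abbrev V : Set ZFSet.{u} := Set.univ

/-- A class is transitive if it contains all elements of its elements. The inner models below are
transitive classes `M` that come with an elementary embedding of `V` into `M`; such a class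
satisfies all axioms of ZFC by elementarity, and it contains all ordinals because the embedding
maps each ordinal `α` to an ordinal of `M` that is at least `α`. -/
def IsTransitiveClass (M : Set ZFSet.{u}) : Prop :=
  ∀ x ∈ M, ∀ y ∈ x, y ∈ M

/-- The relation symbols of the language of set theory: one binary symbol. -/
inductive SetRel : ℕ → Type
  | mem : SetRel 2

/-- The first-order language of set theory. -/
def setLang : FirstOrder.Language.{0, 0} := ⟨fun _ => Empty, SetRel⟩

/-- Each class is a structure for the language of set theory, with the true membership relation. -/
instance memStructure (P : Set ZFSet.{u}) : setLang.Structure P where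
  funMap := fun f _ => Empty.elim f
  RelMap := fun r => match r with
    | .mem => fun x => (x 0).1 ∈ (x 1).1

/-- `U` is a `P`-ultrafilter on the set `X ∈ P`: an ultrafilter on the Boolean algebra of those
subsets of `X` that belong to `P`. The set `U` itself need not belong to `P`. -/
structure IsUltrafilterOn (P : Set ZFSet.{u}) (X U : ZFSet.{u}) : Prop where
  base_mem : X ∈ P
  mem_and_subset : ∀ A ∈ U, A ∈ P ∧ A ⊆ X
  univ_mem : X ∈ U
  empty_notMem : ∅ ∉ U
  inter_mem : ∀ A ∈ U, ∀ B ∈ U, A ∩ B ∈ U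
  superset_mem : ∀ A ∈ U, ∀ B ∈ P, A ⊆ B → B ⊆ X → B ∈ U
  mem_or_diff_mem : ∀ A ∈ P, A ⊆ X → A ∈ U ∨ X \ A ∈ U

/-- The functions with domain `X` that belong to `P`, as sets of ordered pairs. -/
def FunIn (P : Set ZFSet.{u}) (X : ZFSet.{u}) : Type (u + 1) :=
  {f : ZFSet.{u} // f ∈ P ∧ ∃ Y, ZFSet.IsFunc X Y f}

/-- The set `{x ∈ X : f x = g x}`. -/
noncomputable def eqSet {P : Set ZFSet.{u}} {X : ZFSet.{u}} (f g : FunIn P X) : ZFSet.{u} :=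
  X.sep fun x => ∃ y, ZFSet.pair x y ∈ f.1 ∧ ZFSet.pair x y ∈ g.1

/-- The set `{x ∈ X : f x ∈ g x}`. -/
noncomputable def memSet {P : Set ZFSet.{u}} {X : ZFSet.{u}} (f g : FunIn P X) : ZFSet.{u} :=
  X.sep fun x => ∃ y z, ZFSet.pair x y ∈ f.1 ∧ ZFSet.pair x z ∈ g.1 ∧ y ∈ z

/-- `i : P → Q` is the ultrapower embedding `j_U^P : P → M_U^P`, where `U` is a `P`-ultrafilter
on `X`. That is, `Q` is the transitive collapse of the ultrapower of `P` by `U` formed with the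
functions in `P`, the map `cls` sends a function `f` to (the collapse of) its class `[f]_U`, and
`i a = [c_a]_U` for the constant function `c_a = X × {a}`. -/
def IsUltrapowerBy (P Q : Set ZFSet.{u}) (X U : ZFSet.{u}) (i : P → Q) : Prop :=
  IsUltrafilterOn P X U ∧ IsTransitiveClass Q ∧
    ∃ cls : FunIn P X → Q,
      Function.Surjective cls ∧
      (∀ f g, cls f = cls g ↔ eqSet f g ∈ U) ∧
      (∀ f g, (cls f).1 ∈ (cls g).1 ↔ memSet f g ∈ U) ∧
      (∀ a : P, ∃ c : FunIn P X, c.1 = X.prod {a.1} ∧ cls c = i a)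

/-- The elementary embedding `i : P → Q` is an ultrapower embedding of `P`. -/
def IsUltrapowerEmbedding {P Q : Set ZFSet.{u}} (i : P ↪ₑ[setLang] Q) : Prop :=
  ∃ X U, IsUltrapowerBy P Q X U i

/-- The elementary embedding `i : P → Q` is an internal ultrapower embedding of `P`: the
ultrapower embedding by a `P`-ultrafilter that belongs to `P`. -/
def IsInternalUltrapowerEmbedding {P Q : Set ZFSet.{u}} (i : P ↪ₑ[setLang] Q) : Prop :=
  ∃ X U, U ∈ P ∧ IsUltrapowerBy P Q X U i

/-- `(i₀, i₁) : (M₀, M₁) → N` is a semicomparison of `(j₀, j₁)`. -/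
def IsSemicomparison {M₀ M₁ N : Set ZFSet.{u}}
    (j₀ : V.{u} ↪ₑ[setLang] M₀) (j₁ : V.{u} ↪ₑ[setLang] M₁)
    (i₀ : M₀ ↪ₑ[setLang] N) (i₁ : M₁ ↪ₑ[setLang] N) : Prop :=
  (∀ x, i₀ (j₀ x) = i₁ (j₁ x)) ∧ IsInternalUltrapowerEmbedding i₁

/-- `(i₀, i₁) : (M₀, M₁) → N` is a comparison of `(j₀, j₁)`. -/
def IsComparison {M₀ M₁ N : Set ZFSet.{u}}
    (j₀ : V.{u} ↪ₑ[setLang] M₀) (j₁ : V.{u} ↪ₑ[setLang] M₁)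
    (i₀ : M₀ ↪ₑ[setLang] N) (i₁ : M₁ ↪ₑ[setLang] N) : Prop :=
  IsSemicomparison j₀ j₁ i₀ i₁ ∧ IsSemicomparison j₁ j₀ i₁ i₀

/-- The Ultrapower Axiom: every pair of ultrapower embeddings of `V` admits a comparison. -/
def UA : Prop :=
  ∀ (M₀ M₁ : Set ZFSet.{u}) (j₀ : V.{u} ↪ₑ[setLang] M₀) (j₁ : V.{u} ↪ₑ[setLang] M₁),
    IsUltrapowerEmbedding j₀ → IsUltrapowerEmbedding j₁ →
      ∃ (N : Set ZFSet.{u}) (i₀ : M₀ ↪ₑ[setLang] N) (i₁ : M₁ ↪ₑ[setLang] N),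
        IsTransitiveClass N ∧ IsComparison j₀ j₁ i₀ i₁

/-- `M` is an ultrapower of the universe. -/
def IsUltrapowerOfV (M : Set ZFSet.{u}) : Prop :=
  ∃ j : V.{u} ↪ₑ[setLang] M, IsUltrapowerEmbedding j

/-- `M ^ X ⊆ M`: every function from the set `X` to `M` belongs to `M`. -/
def PowSubset (M : Set ZFSet.{u}) (X : ZFSet.{u}) : Prop :=
  ∀ Y f : ZFSet.{u}, ZFSet.IsFunc X Y f → (∀ y ∈ Y, y ∈ M) → f ∈ M

/-- `D` is a countably complete ultrafilter on the set `X`. -/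
def IsCountablyCompleteUltrafilter (X D : ZFSet.{u}) : Prop :=
  IsUltrafilterOn V X D ∧
    ∀ A : ℕ → ZFSet.{u}, (∀ n, A n ∈ D) → X.sep (fun x => ∀ n, x ∈ A n) ∈ D

end UltrapowerAxiom

namespace UltrapowerAxiom

open Filter

/-! For finite `γ`, `D` is hereditarily finite over elements of `M`. Otherwise let `κ = |γ|` and `μ
= κ⁺ ≤ λ`, write `j : V → M` for the given embedding and `k : V → M₁` for the ultrapower by `D`, and
let UA supply `i : M → N` and `h : M₁ → N`, both internal, with `i ∘ j = h ∘ k`.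

The aim is to exhibit `D` as an ultrafilter derived from `i` using only parameters in `M`. By
closure, `C = j''μ` is in `M`. It is closed under unions of subsets of order type `ω`, because an
elementary embedding maps such a set to its pointwise image (`isOmegaClosedIn_image`). Hence `i(C)`
is closed in the same sense in `N`. As `h` is internal, `T = {t ∈ k(μ) : h(t) ∈ i(C)}` is in `M₁`
(`exists_preimage`); it contains `k''μ` and inherits the closure, so `T = [T_x]_D` with `T_x` an
`ω`-club of `μ` for almost all `x` (`eventually_isOmegaClub`).

Fix `f : μ → γ` taking every value on every `ω`-club (`exists_omegaStationary_partition`). Choose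
`t_x ∈ T_x` with `f(t_x) = x` and put `τ = [t]_D`. For `A ⊆ γ` and `A' = f⁻¹(A)`: `A ∈ D` iff `τ ∈
k(A')` iff `h(τ) ∈ i(j(A'))`. Since `h(τ) ∈ i(C)` and `j(A') ∩ C = j''A'`, this holds iff `h(τ) ∈
i(j''A')`. The map `A ↦ j''A'` is coded by the relation `{(j(x), f(x)) : x < μ}` in `M`, and `i` is
internal to `M`, so `D ∈ M` (`exists_derived`). -/

/-! ### Functions of a class -/

/-- The value at `x` of a function of a class. -/
noncomputable def FunIn.apply {P : Set ZFSet.{u}} {X : ZFSet.{u}} (f : FunIn P X) (x : ZFSet.{u}) :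
    ZFSet.{u} :=
  Classical.epsilon fun y => ZFSet.pair x y ∈ f.1

theorem FunIn.pair_mem_iff {P : Set ZFSet.{u}} {X : ZFSet.{u}} (f : FunIn P X) {x y : ZFSet.{u}}
    (hx : x ∈ X) : ZFSet.pair x y ∈ f.1 ↔ f.apply x = y := by
  obtain ⟨_, Y, -, h⟩ := f.2
  obtain ⟨w, hw, hu⟩ := h x hx
  have h1 : ZFSet.pair x (f.apply x) ∈ f.1 :=
    Classical.epsilon_spec (p := fun y => ZFSet.pair x y ∈ f.1) ⟨w, hw⟩
  constructor
  · intro h2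
    rw [hu _ h1, hu _ h2]
  · rintro rfl
    exact h1

theorem sep_congr {X : ZFSet.{u}} {p q : ZFSet.{u} → Prop} (h : ∀ x ∈ X, (p x ↔ q x)) :
    X.sep p = X.sep q := by
  ext x
  simp only [ZFSet.mem_sep]
  exact and_congr_right (h x)

theorem eqSet_eq {P : Set ZFSet.{u}} {X : ZFSet.{u}} (f g : FunIn P X) :
    eqSet f g = X.sep fun x => f.apply x = g.apply x := by
  ext x
  simp only [eqSet, ZFSet.mem_sep]
  refine and_congr_right fun hx => ?_
  simp only [f.pair_mem_iff hx, g.pair_mem_iff hx]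
  exact ⟨fun ⟨y, h1, h2⟩ => h1.trans h2.symm, fun h => ⟨_, h, rfl⟩⟩

theorem memSet_eq {P : Set ZFSet.{u}} {X : ZFSet.{u}} (f g : FunIn P X) :
    memSet f g = X.sep fun x => f.apply x ∈ g.apply x := by
  ext x
  simp only [memSet, ZFSet.mem_sep]
  refine and_congr_right fun hx => ?_
  simp only [f.pair_mem_iff hx, g.pair_mem_iff hx]
  exact ⟨fun ⟨y, z, h1, h2, h3⟩ => by rwa [h1, h2], fun h => ⟨_, _, rfl, rfl, h⟩⟩

theorem FunIn.ext {P : Set ZFSet.{u}} {X : ZFSet.{u}} {f g : FunIn P X}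
    (h : ∀ x ∈ X, f.apply x = g.apply x) : f = g := by
  apply Subtype.ext
  have key : ∀ f g : FunIn P X, (∀ x ∈ X, f.apply x = g.apply x) → ∀ p ∈ f.1, p ∈ g.1 := by
    intro f g h p hp
    obtain ⟨_, Y, hs, _⟩ := f.2
    obtain ⟨a, ha, b, hb, rfl⟩ := ZFSet.mem_prod.1 (hs hp)
    rw [f.pair_mem_iff ha] at hp
    rw [g.pair_mem_iff ha, ← h a ha, hp]
  ext p
  exact ⟨key f g h p, key g f (fun x hx => (h x hx).symm) p⟩

attribute [local instance] Classical.allZFSetDefinable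

/-- The restriction of an operation on sets to a set. -/
noncomputable def FunIn.ofFun (X : ZFSet.{u}) (a : ZFSet.{u} → ZFSet.{u}) : FunIn V X :=
  ⟨ZFSet.map a X, trivial, ZFSet.image a X,
    ZFSet.map_isFunc.2 fun z hz => ZFSet.mem_image.2 ⟨z, hz, rfl⟩⟩

theorem FunIn.ofFun_apply {X x : ZFSet.{u}} (a : ZFSet.{u} → ZFSet.{u}) (hx : x ∈ X) :
    (FunIn.ofFun X a).apply x = a x := by
  rw [← FunIn.pair_mem_iff _ hx]
  exact ZFSet.mem_map.2 ⟨x, hx, rfl⟩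

theorem FunIn.apply_of_eq_prod {P : Set ZFSet.{u}} {X a x : ZFSet.{u}} {f : FunIn P X}
    (hf : f.1 = X.prod {a}) (hx : x ∈ X) : f.apply x = a := by
  rw [← f.pair_mem_iff hx, hf]
  simp [hx]

/-! ### Ultrafilters on sets as ultrafilters on the universe -/

/-- A `V`-ultrafilter on a set, as an ultrafilter on the type of all sets. -/
noncomputable def IsUltrafilterOn.toUltrafilter {X U : ZFSet.{u}} (h : IsUltrafilterOn V X U) :
    Ultrafilter ZFSet.{u} :=
  Ultrafilter.ofComplNotMemIff
    { sets := {A | X.sep (· ∈ A) ∈ U}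
      univ_sets := by
        have : X.sep (· ∈ (Set.univ : Set ZFSet.{u})) = X := by ext; simp
        rw [Set.mem_ofPred_eq, this]
        exact h.univ_mem
      sets_of_superset := fun {A B} hA hAB => h.superset_mem _ hA _ trivial
        (fun x hx => by
          simp only [ZFSet.mem_sep] at hx ⊢
          exact ⟨hx.1, hAB hx.2⟩) ZFSet.sep_subset
      inter_sets := fun {A B} hA hB => by
        have := h.inter_mem _ hA _ hB
        have e : X.sep (· ∈ A) ∩ X.sep (· ∈ B) = X.sep (· ∈ A ∩ B) := by
          ext; simp; tauto
        rwa [e] at this }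
    (by
      intro A
      have e : X \ X.sep (· ∈ A) = X.sep (· ∈ Aᶜ) := by ext; simp; tauto
      have h1 := h.mem_or_diff_mem (X.sep (· ∈ A)) trivial ZFSet.sep_subset
      rw [e] at h1
      change ¬ (X.sep (· ∈ Aᶜ) ∈ U) ↔ X.sep (· ∈ A) ∈ U
      refine ⟨fun h2 => h1.resolve_right h2, fun h2 h3 => h.empty_notMem ?_⟩
      have := h.inter_mem _ h2 _ h3
      have e2 : X.sep (· ∈ A) ∩ X.sep (· ∈ Aᶜ) = ∅ := by
        ext; simp; tauto
      rwa [e2] at this)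

theorem IsUltrafilterOn.eventually_iff {X U : ZFSet.{u}} (h : IsUltrafilterOn V X U)
    {p : ZFSet.{u} → Prop} : (∀ᶠ x in h.toUltrafilter, p x) ↔ X.sep p ∈ U :=
  Iff.rfl

theorem IsUltrafilterOn.eventually_mem {X U : ZFSet.{u}} (h : IsUltrafilterOn V X U) :
    ∀ᶠ x in h.toUltrafilter, x ∈ X := by
  rw [h.eventually_iff]
  have : X.sep (· ∈ X) = X := by ext; simp
  rw [this]
  exact h.univ_mem

theorem IsUltrafilterOn.eventually_mem_iff {X U A : ZFSet.{u}} (h : IsUltrafilterOn V X U)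
    (hA : A ⊆ X) : (∀ᶠ x in h.toUltrafilter, x ∈ A) ↔ A ∈ U := by
  rw [h.eventually_iff]
  have : X.sep (· ∈ A) = A := by
    ext x
    simpa using @hA x
  rw [this]

/-! ### Ultrapowers of the universe -/

/-- `M` is the transitive collapse of the ultrapower of the universe by `F`, and `c` sends an
operation on sets to the collapse of its class. -/
structure Represents (F : Ultrafilter ZFSet.{u}) (M : Set ZFSet.{u})
    (c : (ZFSet.{u} → ZFSet.{u}) → ZFSet.{u}) : Prop where
  trans : IsTransitiveClass M
  mem : ∀ a, c a ∈ M
  surj : ∀ y ∈ M, ∃ a, c a = y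
  eq_iff : ∀ a b, c a = c b ↔ ∀ᶠ x in F, a x = b x
  mem_iff : ∀ a b, c a ∈ c b ↔ ∀ᶠ x in F, a x ∈ b x

theorem IsUltrapowerBy.exists_represents {M : Set ZFSet.{u}} {X U : ZFSet.{u}}
    {j : V.{u} → M} (h : IsUltrapowerBy V M X U j) :
    ∃ c, Represents h.1.toUltrafilter M c ∧ ∀ x, (j x).1 = c fun _ => x.1 := by
  obtain ⟨hU, hM, cls, hsurj, heq, hmem, hc⟩ := h
  refine ⟨fun a => (cls (FunIn.ofFun X a)).1, ⟨hM, fun a => (cls _).2, ?_, ?_, ?_⟩, ?_⟩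
  · intro y hy
    obtain ⟨f, hf⟩ := hsurj ⟨y, hy⟩
    refine ⟨f.apply, ?_⟩
    rw [FunIn.ext (f := FunIn.ofFun X f.apply) (g := f) fun x hx => FunIn.ofFun_apply _ hx, hf]
  · intro a b
    rw [← Subtype.ext_iff, heq, hU.eventually_iff, eqSet_eq]
    rw [sep_congr]
    intro x hx
    rw [FunIn.ofFun_apply a hx, FunIn.ofFun_apply b hx]
  · intro a b
    rw [hmem, hU.eventually_iff, memSet_eq]
    rw [sep_congr]
    intro x hx
    rw [FunIn.ofFun_apply a hx, FunIn.ofFun_apply b hx]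
  · intro x
    obtain ⟨f, hf, hfx⟩ := hc x
    rw [← hfx, FunIn.ext (f := f) (g := FunIn.ofFun X fun _ => x.1)]
    intro y hy
    rw [FunIn.ofFun_apply _ hy, FunIn.apply_of_eq_prod hf hy]

theorem eventually_exists_iff {F : Filter ZFSet.{u}} {Q : ZFSet.{u} → ZFSet.{u} → Prop} :
    (∀ᶠ x in F, ∃ y, Q x y) ↔ ∃ y : ZFSet.{u} → ZFSet.{u}, ∀ᶠ x in F, Q x (y x) := by
  constructor
  · intro h
    refine ⟨fun x => Classical.epsilon (Q x), h.mono fun x hx => Classical.epsilon_spec hx⟩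
  · rintro ⟨y, hy⟩
    exact hy.mono fun x hx => ⟨_, hx⟩

namespace Represents

variable {F : Ultrafilter ZFSet.{u}} {M : Set ZFSet.{u}} {c : (ZFSet.{u} → ZFSet.{u}) → ZFSet.{u}}

theorem mem_c_iff (hc : Represents F M c) {y : ZFSet.{u}} {b : ZFSet.{u} → ZFSet.{u}} :
    y ∈ c b ↔ ∃ a, y = c a ∧ ∀ᶠ x in F, a x ∈ b x := by
  constructor
  · intro h
    obtain ⟨a, rfl⟩ := hc.surj y (hc.trans _ (hc.mem b) _ h)
    exact ⟨a, rfl, (hc.mem_iff _ _).1 h⟩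
  · rintro ⟨a, rfl, h⟩
    exact (hc.mem_iff _ _).2 h

theorem subset_iff (hc : Represents F M c) {a b : ZFSet.{u} → ZFSet.{u}} :
    c a ⊆ c b ↔ ∀ᶠ x in F, a x ⊆ b x := by
  constructor
  · intro h
    by_contra hn
    rw [← Ultrafilter.eventually_not] at hn
    have h1 : ∀ᶠ x in F, ∃ y, y ∈ a x ∧ y ∉ b x := hn.mono fun x hx => by
      simpa [ZFSet.subset_def] using hx
    obtain ⟨y, hy⟩ := eventually_exists_iff.1 h1
    have h2 := h ((hc.mem_iff y a).2 (hy.mono fun x hx => hx.1))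
    rw [hc.mem_iff] at h2
    obtain ⟨x, hx⟩ := (h2.and hy).exists
    exact hx.2.2 hx.1
  · intro h y hy
    obtain ⟨y, rfl, hy'⟩ := hc.mem_c_iff.1 hy
    rw [hc.mem_iff]
    filter_upwards [h, hy'] with x h1 h2 using h1 h2

/-! ### Basic set operations computed coordinatewise in an ultrapower -/

theorem c_insert (hc : Represents F M c) (a b : ZFSet.{u} → ZFSet.{u}) :
    c (fun x => insert (a x) (b x)) = insert (c a) (c b) := by
  ext y
  simp only [hc.mem_c_iff, ZFSet.mem_insert_iff]
  constructor
  · rintro ⟨y, rfl, h⟩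
    rw [Ultrafilter.eventually_or] at h
    rw [hc.eq_iff]
    exact h.imp id fun h => ⟨y, rfl, h⟩
  · rintro (rfl | ⟨y, rfl, h⟩)
    · exact ⟨a, rfl, by simp⟩
    · exact ⟨y, rfl, h.mono fun x hx => Or.inr hx⟩

theorem c_empty (hc : Represents F M c) : c (fun _ => ∅) = ∅ := by
  ext y
  simp [hc.mem_c_iff, F.neBot.ne]

theorem c_singleton (hc : Represents F M c) (a : ZFSet.{u} → ZFSet.{u}) :
    c (fun x => {a x}) = {c a} := by
  have := hc.c_insert a fun _ => ∅
  rw [hc.c_empty] at this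
  convert this using 2 <;> simp

theorem c_pair (hc : Represents F M c) (a b : ZFSet.{u} → ZFSet.{u}) :
    c (fun x => ZFSet.pair (a x) (b x)) = ZFSet.pair (c a) (c b) := by
  have h1 := hc.c_insert (fun x => {a x}) fun x => {{a x, b x}}
  have h2 := hc.c_insert a fun x => {b x}
  rw [hc.c_singleton, hc.c_singleton, h2, hc.c_singleton] at h1
  exact h1

theorem c_sUnion (hc : Represents F M c) (a : ZFSet.{u} → ZFSet.{u}) :
    c (fun x => (a x).sUnion) = (c a).sUnion := by
  ext y
  simp only [hc.mem_c_iff, ZFSet.mem_sUnion]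
  constructor
  · rintro ⟨y, rfl, h⟩
    obtain ⟨z, hz⟩ := eventually_exists_iff.1 h
    exact ⟨c z, ⟨z, rfl, hz.mono fun x hx => hx.1⟩, (hc.mem_iff _ _).2 (hz.mono fun x hx => hx.2)⟩
  · rintro ⟨_, ⟨z, rfl, hz⟩, hy⟩
    obtain ⟨y, rfl, hy'⟩ := hc.mem_c_iff.1 hy
    exact ⟨y, rfl, by filter_upwards [hy', hz] with x h1 h2 using ⟨_, h2, h1⟩⟩

/-- Here `q` plays the ultrapower of the predicates `p x`; each use supplies its own instance of Łoś
through `hpq`. -/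
theorem c_sep (hc : Represents F M c) (a : ZFSet.{u} → ZFSet.{u})
    (p : ZFSet.{u} → ZFSet.{u} → Prop) (q : ZFSet.{u} → Prop)
    (hpq : ∀ z, q (c z) ↔ ∀ᶠ x in F, p x (z x)) :
    c (fun x => (a x).sep (p x)) = (c a).sep q := by
  ext y
  simp only [hc.mem_c_iff, ZFSet.mem_sep]
  constructor
  · rintro ⟨y, rfl, h⟩
    exact ⟨⟨y, rfl, h.mono fun x hx => hx.1⟩, (hpq y).2 (h.mono fun x hx => hx.2)⟩
  · rintro ⟨⟨y, rfl, h⟩, hy⟩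
    exact ⟨y, rfl, h.and ((hpq y).1 hy)⟩

/-- `M` contains the subset of `Y` defined by an element `W` of `M` as a measure quantifier, applied
to a relation on `M` that is the ultrapower of a relation on sets. -/
theorem sep_sep_mem (hc : Represents F M c) {R : ZFSet.{u} → ZFSet.{u} → ZFSet.{u} → ZFSet.{u} → Prop}
    (hR : ∀ p q z a, R (c p) (c q) (c z) (c a) ↔ ∀ᶠ x in F, R (p x) (q x) (z x) (a x))
    {p q X W Y : ZFSet.{u}} (hp : p ∈ M) (hq : q ∈ M) (hX : X ∈ M) (hW : W ∈ M) (hY : Y ∈ M) :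
    (Y.sep fun a => (X.sep fun z => R p q z a) ∈ W) ∈ M := by
  obtain ⟨p, rfl⟩ := hc.surj p hp
  obtain ⟨q, rfl⟩ := hc.surj q hq
  obtain ⟨X, rfl⟩ := hc.surj X hX
  obtain ⟨W, rfl⟩ := hc.surj W hW
  obtain ⟨Y, rfl⟩ := hc.surj Y hY
  rw [← hc.c_sep Y (fun x a => ((X x).sep fun z => R (p x) (q x) z a) ∈ W x)]
  · exact hc.mem _
  · intro a
    rw [← hc.mem_iff, hc.c_sep X (fun x z => R (p x) (q x) z (a x)) (fun z => R (c p) (c q) z (c a))]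
    exact fun z => hR p q z a

theorem mem_of_pair_mem (hc : Represents F M c) {x y s : ZFSet.{u}} (hs : s ∈ M)
    (h : ZFSet.pair x y ∈ s) : x ∈ M ∧ y ∈ M := by
  have h1 := hc.trans _ hs _ h
  have h2 := hc.trans _ h1 {x, y} (by simp [ZFSet.pair])
  exact ⟨hc.trans _ h2 _ (by simp), hc.trans _ h2 _ (by simp)⟩

theorem exists_pair_mem_iff (hc : Represents F M c) (s z t : ZFSet.{u} → ZFSet.{u}) :
    (∃ y, ZFSet.pair (c z) y ∈ c s ∧ c t ∈ y) ↔
      ∀ᶠ x in F, ∃ y, ZFSet.pair (z x) y ∈ s x ∧ t x ∈ y := by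
  rw [eventually_exists_iff]
  constructor
  · rintro ⟨y, h1, h2⟩
    obtain ⟨y, rfl⟩ := hc.surj y (hc.mem_of_pair_mem (hc.mem s) h1).2
    rw [← hc.c_pair, hc.mem_iff] at h1
    exact ⟨y, h1.and ((hc.mem_iff _ _).1 h2)⟩
  · rintro ⟨y, hy⟩
    refine ⟨c y, ?_, (hc.mem_iff _ _).2 (hy.mono fun x hx => hx.2)⟩
    rw [← hc.c_pair, hc.mem_iff]
    exact hy.mono fun x hx => hx.1

theorem exists_pair_mem_comp_iff (hc : Represents F M c) (g r z t : ZFSet.{u} → ZFSet.{u}) :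
    (∃ y a, ZFSet.pair (c z) y ∈ c g ∧ ZFSet.pair y a ∈ c r ∧ a ∈ c t) ↔
      ∀ᶠ x in F, ∃ y a, ZFSet.pair (z x) y ∈ g x ∧ ZFSet.pair y a ∈ r x ∧ a ∈ t x := by
  rw [eventually_exists_iff]
  simp only [eventually_exists_iff]
  constructor
  · rintro ⟨y, a, h1, h2, h3⟩
    obtain ⟨y, rfl⟩ := hc.surj y (hc.mem_of_pair_mem (hc.mem g) h1).2
    obtain ⟨a, rfl⟩ := hc.surj a (hc.mem_of_pair_mem (hc.mem r) h2).2
    rw [← hc.c_pair, hc.mem_iff] at h1 h2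
    rw [hc.mem_iff] at h3
    exact ⟨y, a, h1.and (h2.and h3)⟩
  · rintro ⟨y, a, h⟩
    refine ⟨c y, c a, ?_, ?_, ?_⟩
    · rw [← hc.c_pair, hc.mem_iff]
      exact h.mono fun x hx => hx.1
    · rw [← hc.c_pair, hc.mem_iff]
      exact h.mono fun x hx => hx.2.1
    · rw [hc.mem_iff]
      exact h.mono fun x hx => hx.2.2

/-! ### Closure properties of an ultrapower -/

theorem empty_mem (hc : Represents F M c) : ∅ ∈ M := hc.c_empty ▸ hc.mem _

theorem insert_mem (hc : Represents F M c) {x y : ZFSet.{u}} (hx : x ∈ M) (hy : y ∈ M) :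
    insert x y ∈ M := by
  obtain ⟨x, rfl⟩ := hc.surj x hx
  obtain ⟨y, rfl⟩ := hc.surj y hy
  exact hc.c_insert x y ▸ hc.mem _

theorem pair_mem (hc : Represents F M c) {x y : ZFSet.{u}} (hx : x ∈ M) (hy : y ∈ M) :
    ZFSet.pair x y ∈ M := by
  obtain ⟨x, rfl⟩ := hc.surj x hx
  obtain ⟨y, rfl⟩ := hc.surj y hy
  exact hc.c_pair x y ▸ hc.mem _

/-- A transitive collapse of an ultrapower of the universe contains its finite subsets. -/
theorem mem_of_finite (hc : Represents F M c) {A : ZFSet.{u}} (hfin : (A : Set ZFSet.{u}).Finite)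
    (hA : ∀ x ∈ A, x ∈ M) : A ∈ M := by
  have key : ∀ s : Set ZFSet.{u}, s.Finite → s ⊆ M → ∃ B ∈ M, (B : Set ZFSet.{u}) = s := by
    intro s hs
    induction s, hs using Set.Finite.induction_on with
    | empty => exact fun _ => ⟨∅, hc.empty_mem, by simp⟩
    | @insert a s _ _ ih =>
      intro h
      obtain ⟨B, hB, rfl⟩ := ih fun x hx => h (Or.inr hx)
      exact ⟨insert a B, hc.insert_mem (h (Or.inl rfl)) hB, by simp⟩
  obtain ⟨B, hB, h⟩ := key _ hfin hA
  rwa [← SetLike.coe_injective h]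

/-- The range of a relation in `M` is in `M`. -/
theorem range_mem (hc : Represents F M c) {f A : ZFSet.{u}} (hf : f ∈ M)
    (hA : ∀ y, y ∈ A ↔ ∃ x, ZFSet.pair x y ∈ f) : A ∈ M := by
  obtain ⟨f, rfl⟩ := hc.surj f hf
  have : A = c fun x => ((f x).sUnion.sUnion).sep fun y => ∃ z, ZFSet.pair z y ∈ f x := by
    rw [hc.c_sep (fun x => (f x).sUnion.sUnion) (fun x y => ∃ z, ZFSet.pair z y ∈ f x)
      (fun y => ∃ z, ZFSet.pair z y ∈ c f)]
    · ext y
      rw [hA, hc.c_sUnion fun x => (f x).sUnion, hc.c_sUnion]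
      simp only [ZFSet.mem_sep, ZFSet.mem_sUnion]
      refine ⟨fun ⟨x, hx⟩ => ⟨⟨{x, y}, ⟨_, hx, by simp [ZFSet.pair]⟩, by simp⟩, x, hx⟩, And.right⟩
    · intro y
      rw [eventually_exists_iff]
      constructor
      · rintro ⟨z, h⟩
        obtain ⟨z, rfl⟩ := hc.surj z (hc.mem_of_pair_mem (hc.mem f) h).1
        rw [← hc.c_pair, hc.mem_iff] at h
        exact ⟨z, h⟩
      · rintro ⟨z, h⟩
        exact ⟨c z, by rwa [← hc.c_pair, hc.mem_iff]⟩
  exact this ▸ hc.mem _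

theorem image_mem (hc : Represents F M c) {L Y : ZFSet.{u}} (hpow : PowSubset M L) (hY : Y ⊆ L)
    (e : ZFSet.{u} → ZFSet.{u}) (he : ∀ x ∈ Y, e x ∈ M) : ZFSet.image e Y ∈ M := by
  classical
  obtain rfl | ⟨x₀, hx₀⟩ := Y.eq_empty_or_nonempty
  · convert hc.empty_mem
    ext; simp [ZFSet.mem_image]
  -- `PowSubset` concerns functions on all of `L`, so `e` is extended by a value it already takes,
  -- which keeps the range unchanged.
  let e' : ZFSet.{u} → ZFSet.{u} := fun x => if x ∈ Y then e x else e x₀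
  have h1 : ZFSet.image e Y = ZFSet.image e' L := by
    ext y
    simp only [ZFSet.mem_image]
    constructor
    · rintro ⟨x, hx, rfl⟩
      exact ⟨x, hY hx, if_pos hx⟩
    · rintro ⟨x, hx, rfl⟩
      by_cases h : x ∈ Y
      · exact ⟨x, h, (if_pos h).symm⟩
      · exact ⟨x₀, hx₀, (if_neg h).symm⟩
  have h2 : ZFSet.map e' L ∈ M := by
    apply hpow (ZFSet.image e Y)
    · rw [h1]
      exact ZFSet.map_isFunc.2 fun z hz => ZFSet.mem_image.2 ⟨z, hz, rfl⟩
    · intro y hy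
      obtain ⟨x, hx, rfl⟩ := ZFSet.mem_image.1 hy
      exact he x hx
  refine hc.range_mem h2 fun y => ?_
  rw [h1]
  simp only [ZFSet.mem_image, ZFSet.mem_map, ZFSet.pair_inj]
  exact ⟨fun ⟨x, hx, h⟩ => ⟨x, x, hx, rfl, h⟩, fun ⟨_, x, hx, _, h⟩ => ⟨x, hx, h⟩⟩

theorem mem_of_subset (hc : Represents F M c) {L Y : ZFSet.{u}} (hpow : PowSubset M L)
    (hY : Y ⊆ L) (hM : ∀ x ∈ Y, x ∈ M) : Y ∈ M := by
  have := hc.image_mem hpow hY (fun x => x) hM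
  convert this
  ext; simp [ZFSet.mem_image]

theorem toZFSet_mem (hc : Represents F M c) {o a : Ordinal.{u}} (hpow : PowSubset M o.toZFSet)
    (ha : a ≤ o) : a.toZFSet ∈ M := by
  induction a using WellFoundedLT.induction with
  | ind a ih =>
    refine hc.mem_of_subset hpow (Ordinal.toZFSet_subset_toZFSet_iff.2 ha) fun x hx => ?_
    obtain ⟨b, hb, rfl⟩ := Ordinal.mem_toZFSet_iff.1 hx
    exact ih b hb (hb.le.trans ha)

/-- Closure puts every subset of `Y` into `M`, so the power set as computed in `M` is the true one.
-/
theorem powerset_mem (hc : Represents F M c) {L Y : ZFSet.{u}} (hpow : PowSubset M L)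
    (hY : Y ⊆ L) (hM : Y ∈ M) : Y.powerset ∈ M := by
  have hsub : ∀ A ⊆ Y, A ∈ M := fun A hA =>
    hc.mem_of_subset hpow (fun x hx => hY (hA hx)) fun x hx => hc.trans _ hM _ (hA hx)
  obtain ⟨Y, rfl⟩ := hc.surj Y hM
  have : (c Y).powerset = c fun x => (Y x).powerset := by
    ext A
    simp only [ZFSet.mem_powerset, hc.mem_c_iff, ← hc.subset_iff]
    constructor
    · intro h
      obtain ⟨A, rfl⟩ := hc.surj A (hsub A h)
      exact ⟨A, rfl, h⟩
    · rintro ⟨A, rfl, h⟩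
      exact h
  exact this ▸ hc.mem _

end Represents

end UltrapowerAxiom

namespace UltrapowerAxiom

/-- The membership symbol. -/
def memSymbol : setLang.Relations 2 := SetRel.mem

/-! ### First-order properties of transitive classes -/

/-- A property of sequences of elements of a class that is uniformly expressed by a first-order
formula in all transitive classes. -/
def IsFirstOrder (R : Set ZFSet.{u} → (ℕ → ZFSet.{u}) → Prop) : Prop :=
  ∃ φ : setLang.Formula ℕ, ∀ P : Set ZFSet.{u}, IsTransitiveClass P →
    ∀ v : ℕ → P, φ.Realize v ↔ R P fun n => (v n).1

namespace IsFirstOrder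

variable {R S : Set ZFSet.{u} → (ℕ → ZFSet.{u}) → Prop}

theorem mem (a b : ℕ) : IsFirstOrder.{u} fun _ v => v a ∈ v b := by
  refine ⟨Language.Relations.formula₂ memSymbol (.var a) (.var b), fun P _ v => ?_⟩
  rw [Language.Formula.realize_rel₂]
  rfl

theorem eq (a b : ℕ) : IsFirstOrder.{u} fun _ v => v a = v b := by
  refine ⟨Language.Term.equal (.var a) (.var b), fun P _ v => ?_⟩
  rw [Language.Formula.realize_equal, Subtype.ext_iff]
  rfl

theorem not (h : IsFirstOrder R) : IsFirstOrder fun P v => ¬ R P v := by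
  obtain ⟨φ, hφ⟩ := h
  exact ⟨φ.not, fun P hP v => by rw [Language.Formula.realize_not, hφ P hP]⟩

theorem imp (h : IsFirstOrder R) (h' : IsFirstOrder S) : IsFirstOrder fun P v => R P v → S P v := by
  obtain ⟨φ, hφ⟩ := h
  obtain ⟨ψ, hψ⟩ := h'
  exact ⟨φ.imp ψ, fun P hP v => by rw [Language.Formula.realize_imp, hφ P hP, hψ P hP]⟩

theorem congr (h : IsFirstOrder R) (h' : ∀ P v, S P v ↔ R P v) : IsFirstOrder S := by
  obtain ⟨φ, hφ⟩ := h
  exact ⟨φ, fun P hP v => by rw [hφ P hP, h']⟩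

theorem and (h : IsFirstOrder R) (h' : IsFirstOrder S) : IsFirstOrder fun P v => R P v ∧ S P v :=
  (h.imp h'.not).not.congr fun P v => by tauto

theorem or (h : IsFirstOrder R) (h' : IsFirstOrder S) : IsFirstOrder fun P v => R P v ∨ S P v :=
  (h.not.imp h').congr fun P v => by tauto

theorem all (n : ℕ) (h : IsFirstOrder R) :
    IsFirstOrder fun P v => ∀ x ∈ P, R P (Function.update v n x) := by
  obtain ⟨φ, hφ⟩ := h
  refine ⟨Language.Formula.iAlls Unit
    (φ.relabel fun m => if m = n then Sum.inr () else Sum.inl m), fun P hP v => ?_⟩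
  rw [Language.Formula.realize_iAlls]
  simp only [Language.Formula.realize_relabel, hφ P hP]
  -- The quantified variable `n` becomes the single bound variable; all others keep their values
  -- under `v`.
  have e : ∀ i : Unit → P, (fun m => ((fun a => Sum.elim v i a) ∘
      (fun m => if m = n then Sum.inr () else Sum.inl m) : ℕ → P) m |>.1) =
      Function.update (fun m => (v m).1) n (i ()).1 := by
    intro i
    ext1 m
    by_cases hm : m = n
    · subst hm; simp
    · simp [hm]
  constructor
  · intro h x hx
    have := h fun _ => ⟨x, hx⟩
    rwa [e] at this
  · intro h i
    rw [e]
    exact h _ (i ()).2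

theorem ball (a n : ℕ) (h : IsFirstOrder R) :
    IsFirstOrder fun P v => ∀ x ∈ v a, R P (Function.update v n x) := by
  obtain ⟨φ, hφ⟩ := h
  refine ⟨Language.Formula.iAlls Unit ((Language.Formula.imp
    (Language.Relations.formula₂ memSymbol (.var (Sum.inr ())) (.var (Sum.inl a)))
    (φ.relabel fun m => if m = n then Sum.inr () else Sum.inl m))), fun P hP v => ?_⟩
  rw [Language.Formula.realize_iAlls]
  simp only [Language.Formula.realize_imp, Language.Formula.realize_relabel, hφ P hP]
  have e : ∀ i : Unit → P, (fun m => ((fun a => Sum.elim v i a) ∘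
      (fun m => if m = n then Sum.inr () else Sum.inl m) : ℕ → P) m |>.1) =
      Function.update (fun m => (v m).1) n (i ()).1 := by
    intro i
    ext1 m
    by_cases hm : m = n
    · subst hm; simp
    · simp [hm]
  have e2 : ∀ i : Unit → P, (Language.Formula.Realize
      (Language.Relations.formula₂ memSymbol (.var (Sum.inr ())) (.var (Sum.inl a)))
      fun a => Sum.elim v i a) ↔ (i ()).1 ∈ (v a).1 := by
    intro i
    rw [Language.Formula.realize_rel₂]
    rfl
  constructor
  · intro h x hx
    have := h fun _ => ⟨x, hP _ (v a).2 _ hx⟩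
    rw [e, e2] at this
    exact this hx
  · intro h i
    rw [e, e2]
    exact h _

theorem bex (a n : ℕ) (h : IsFirstOrder R) :
    IsFirstOrder fun P v => ∃ x ∈ v a, R P (Function.update v n x) :=
  (h.not.ball a n).not.congr fun P v => by push Not; rfl

/-- First-order properties are preserved by elementary embeddings of transitive classes. -/
theorem map_iff (h : IsFirstOrder R) {P Q : Set ZFSet.{u}} (hP : IsTransitiveClass P)
    (hQ : IsTransitiveClass Q) (i : P ↪ₑ[setLang] Q) (v : ℕ → P) :
    R Q (fun n => (i (v n)).1) ↔ R P fun n => (v n).1 := by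
  obtain ⟨φ, hφ⟩ := h
  rw [← hφ P hP, ← i.map_formula φ v, hφ Q hQ]
  rfl

end IsFirstOrder

theorem isFirstOrder_subset (a b : ℕ) : IsFirstOrder.{u} fun _ v => v a ⊆ v b := by
  refine ((IsFirstOrder.mem.{u} (a + b + 1) b).ball a (a + b + 1)).congr fun P v => ?_
  -- The index `a + b + 1` is a variable distinct from `a` and `b`, so binding it leaves the
  -- parameters alone.
  have h : b ≠ a + b + 1 := by omega
  simp only [ZFSet.subset_def, Function.update_self, Function.update_of_ne h]

theorem isFirstOrder_sUnion (a b : ℕ) : IsFirstOrder.{u} fun _ v => v b = (v a).sUnion := by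
  set n := a + b + 1 with hn
  refine ((((IsFirstOrder.mem.{u} n (n + 1)).bex a (n + 1)).ball b n).and
    (((IsFirstOrder.mem.{u} (n + 1) b).ball n (n + 1)).ball a n)).congr fun P v => ?_
  have h1 : a ≠ n := by omega
  have h2 : b ≠ n := by omega
  have h3 : b ≠ n + 1 := by omega
  simp only [Function.update_self, Function.update_of_ne h1, Function.update_of_ne h2,
    Function.update_of_ne h3, Function.update_of_ne n.lt_succ_self.ne]
  constructor
  · intro h
    rw [h]
    exact ⟨fun x hx => ZFSet.mem_sUnion.1 hx, fun y hy x hx => ZFSet.mem_sUnion.2 ⟨y, hy, hx⟩⟩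
  · rintro ⟨h1, h2⟩
    ext x
    exact ⟨fun hx => ZFSet.mem_sUnion.2 (h1 x hx), fun hx =>
      (ZFSet.mem_sUnion.1 hx).elim fun y hy => h2 y hy.1 x hy.2⟩

/-! ### Set operations preserved by elementary embeddings -/

section Elementary

variable {P Q : Set ZFSet.{u}} (i : P ↪ₑ[setLang] Q)

theorem map_mem_map_iff (x y : P) : (i x).1 ∈ (i y).1 ↔ x.1 ∈ y.1 := by
  have := i.map_rel memSymbol ![x, y]
  exact this

theorem map_subset_map (hP : IsTransitiveClass P) (hQ : IsTransitiveClass Q) {x y : P}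
    (h : x.1 ⊆ y.1) : (i x).1 ⊆ (i y).1 :=
  ((isFirstOrder_subset 0 1).map_iff hP hQ i fun n => if n = 0 then x else y).2 h

theorem map_sUnion (hP : IsTransitiveClass P) (hQ : IsTransitiveClass Q) {x y : P}
    (h : y.1 = x.1.sUnion) : (i y).1 = (i x).1.sUnion :=
  ((isFirstOrder_sUnion 0 1).map_iff hP hQ i fun n => if n = 0 then x else y).2 h

theorem map_inter_subset (hP : IsTransitiveClass P) (hQ : IsTransitiveClass Q) {x y z : P}
    (h : x.1 ∩ y.1 ⊆ z.1) : (i x).1 ∩ (i y).1 ⊆ (i z).1 := by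
  have h1 := (((IsFirstOrder.mem.{u} 3 1).imp (IsFirstOrder.mem.{u} 3 2)).ball 0 3).map_iff hP hQ i
    fun n => if n = 0 then x else if n = 1 then y else z
  have h2 := h1.2 (by simpa using fun a ha hb => h (ZFSet.mem_inter.2 ⟨ha, hb⟩))
  intro a ha
  rw [ZFSet.mem_inter] at ha
  simpa using h2 a ha.1 (by simpa using ha.2)

end Elementary

/-! ### Sets of order type `ω` -/

/-- `m` is the least element of `S` with respect to membership. -/
def IsMemLeast (S m : ZFSet.{u}) : Prop :=
  m ∈ S ∧ ∀ z ∈ S, z = m ∨ m ∈ z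

/-- `y` is the next element of `S` after `x` with respect to membership. -/
def IsMemNext (S x y : ZFSet.{u}) : Prop :=
  (x ∈ S ∧ y ∈ S ∧ x ∈ y) ∧ ∀ z ∈ S, (z = y ∨ y ∈ z) ∨ z ∈ x ∨ z = x

/-- The membership relation on `S` has order type `ω`. -/
def IsOmegaSeq (S : ZFSet.{u}) : Prop :=
  (∃ m ∈ S, IsMemLeast S m) ∧ (∀ x ∈ S, ∃ y ∈ S, IsMemNext S x y) ∧
    ∀ y ∈ S, IsMemLeast S y ∨ ∃ x ∈ S, IsMemNext S x y

theorem IsMemLeast.unique {S m n : ZFSet.{u}} (hm : IsMemLeast S m) (hn : IsMemLeast S n) :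
    m = n := by
  rcases hm.2 n hn.1 with h | h
  · exact h.symm
  rcases hn.2 m hm.1 with h' | h'
  · exact h'
  · exact (ZFSet.mem_asymm h h').elim

theorem IsMemNext.unique {S x y z : ZFSet.{u}} (hy : IsMemNext S x y) (hz : IsMemNext S x z) :
    y = z := by
  have key : ∀ y z, IsMemNext S x y → IsMemNext S x z → z = y ∨ y ∈ z := by
    intro y z hy hz
    rcases hy.2 z hz.1.2.1 with h | h | h
    · exact h
    · exact (ZFSet.mem_asymm h hz.1.2.2).elim
    · exact (ZFSet.mem_irrefl x (h ▸ hz.1.2.2)).elim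
  rcases key y z hy hz with h | h
  · exact h.symm
  rcases key z y hz hy with h' | h'
  · exact h'
  · exact (ZFSet.mem_asymm h h').elim

theorem isFirstOrder_isMemLeast (a b : ℕ) :
    IsFirstOrder.{u} fun _ v => IsMemLeast (v a) (v b) := by
  have h := (IsFirstOrder.mem.{u} b a).and
    (((IsFirstOrder.eq.{u} (a + b + 1) b).or (IsFirstOrder.mem.{u} b (a + b + 1))).ball a (a + b + 1))
  refine h.congr fun P v => ?_
  have h2 : b ≠ a + b + 1 := by omega
  simp [IsMemLeast, Function.update_of_ne h2]

theorem isFirstOrder_isMemNext (a b d : ℕ) :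
    IsFirstOrder.{u} fun _ v => IsMemNext (v a) (v b) (v d) := by
  set n := a + b + d + 1 with hn
  have h := ((IsFirstOrder.mem.{u} b a).and ((IsFirstOrder.mem.{u} d a).and
    (IsFirstOrder.mem.{u} b d))).and ((((IsFirstOrder.eq.{u} n d).or (IsFirstOrder.mem.{u} d n)).or
      ((IsFirstOrder.mem.{u} n b).or (IsFirstOrder.eq.{u} n b))).ball a n)
  refine h.congr fun P v => ?_
  have h2 : b ≠ n := by omega
  have h3 : d ≠ n := by omega
  simp [IsMemNext, Function.update_of_ne h2, Function.update_of_ne h3]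

theorem isFirstOrder_isOmegaSeq (a : ℕ) : IsFirstOrder.{u} fun _ v => IsOmegaSeq (v a) := by
  have h := ((isFirstOrder_isMemLeast.{u} a (a + 1)).bex a (a + 1)).and
    ((((isFirstOrder_isMemNext.{u} a (a + 1) (a + 2)).bex a (a + 2)).ball a (a + 1)).and
    (((isFirstOrder_isMemLeast.{u} a (a + 1)).or
      ((isFirstOrder_isMemNext.{u} a (a + 2) (a + 1)).bex a (a + 2))).ball a (a + 1)))
  refine h.congr fun P v => ?_
  simp [IsOmegaSeq]

/-- Iterating the next-element map from the least element reaches everything, by ∈-induction: each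
other element has an immediate predecessor in `S`. -/
theorem IsOmegaSeq.exists_enum {S : ZFSet.{u}} (hS : IsOmegaSeq S) :
    ∃ s : ℕ → ZFSet.{u}, ∀ x, x ∈ S ↔ ∃ n, s n = x := by
  obtain ⟨⟨m, hm, hm'⟩, h1, h2⟩ := hS
  choose! f hf hf' using h1
  have hs : ∀ n, f^[n] m ∈ S := by
    intro n
    induction n with
    | zero => exact hm
    | succ n ih => rw [Function.iterate_succ_apply']; exact hf _ ih
  refine ⟨fun n => f^[n] m, fun x => ⟨fun hx => ?_, fun ⟨n, hn⟩ => hn ▸ hs n⟩⟩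
  induction x using ZFSet.inductionOn with
  | _ x ih =>
  rcases h2 x hx with h | ⟨y, hy, h⟩
  · exact ⟨0, hm'.unique h⟩
  · obtain ⟨n, rfl⟩ := ih y h.1.2.2 hy
    exact ⟨n + 1, (Function.iterate_succ_apply' f n m).trans <| (hf' _ hy).unique h⟩

/-- An elementary embedding maps a set of order type `ω` to its pointwise image. -/
theorem IsOmegaSeq.exists_of_mem_map {P Q : Set ZFSet.{u}} (hP : IsTransitiveClass P)
    (hQ : IsTransitiveClass Q) (i : P ↪ₑ[setLang] Q) {S : P} (hS : IsOmegaSeq S.1) {y : ZFSet.{u}}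
    (hy : y ∈ (i S).1) : ∃ x : P, x.1 ∈ S.1 ∧ (i x).1 = y := by
  have hS' : IsOmegaSeq (i S).1 := ((isFirstOrder_isOmegaSeq 0).map_iff hP hQ i fun _ => S).2 hS
  -- Least elements go to least elements and next elements to next elements, so ∈-induction leaves
  -- no element of `i S` outside the pointwise image.
  induction y using ZFSet.inductionOn with
  | _ y ih =>
  rcases hS'.2.2 y hy with h | ⟨z, hz, h⟩
  · obtain ⟨m, hm, hm'⟩ := hS.1
    refine ⟨⟨m, hP _ S.2 _ hm⟩, hm, ?_⟩
    refine IsMemLeast.unique (S := (i S).1) ?_ h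
    exact ((isFirstOrder_isMemLeast 0 1).map_iff hP hQ i
      fun n => if n = 0 then S else ⟨m, hP _ S.2 _ hm⟩).2 hm'
  · obtain ⟨x, hx, rfl⟩ := ih z h.1.2.2 hz
    obtain ⟨w, hw, hw'⟩ := hS.2.1 x hx
    refine ⟨⟨w, hP _ S.2 _ hw⟩, hw, ?_⟩
    refine IsMemNext.unique (S := (i S).1) (x := (i x).1) ?_ h
    exact ((isFirstOrder_isMemNext 0 1 2).map_iff hP hQ i
      fun n => if n = 0 then S else if n = 1 then x else ⟨w, hP _ S.2 _ hw⟩).2 hw'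

theorem IsOmegaSeq.of_image {S T : ZFSet.{u}} {f : ZFSet.{u} → ZFSet.{u}}
    (hmem : ∀ x y, f x ∈ f y ↔ x ∈ y) (heq : ∀ x y, f x = f y ↔ x = y)
    (hT : ∀ y, y ∈ T ↔ ∃ x ∈ S, f x = y) (h : IsOmegaSeq T) : IsOmegaSeq S := by
  have hfT : ∀ x, f x ∈ T ↔ x ∈ S := fun x => by simp [hT, heq]
  have hleast : ∀ m, IsMemLeast T (f m) → IsMemLeast S m := by
    refine fun m hm => ⟨(hfT m).1 hm.1, fun z hz => ?_⟩
    simpa only [heq, hmem] using hm.2 (f z) ((hfT z).2 hz)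
  have hnext : ∀ x y, IsMemNext T (f x) (f y) → IsMemNext S x y := by
    refine fun x y hm => ⟨by simpa only [hfT, hmem] using hm.1, fun z hz => ?_⟩
    simpa only [heq, hmem] using hm.2 (f z) ((hfT z).2 hz)
  obtain ⟨⟨m, hm, h1⟩, h2, h3⟩ := h
  refine ⟨?_, fun x hx => ?_, fun y hy => ?_⟩
  · obtain ⟨m, hm', rfl⟩ := (hT m).1 hm
    exact ⟨m, hm', hleast m h1⟩
  · obtain ⟨y, hy, h⟩ := h2 (f x) ((hfT x).2 hx)
    obtain ⟨y, hy', rfl⟩ := (hT y).1 hy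
    exact ⟨y, hy', hnext x y h⟩
  · rcases h3 (f y) ((hfT y).2 hy) with h | ⟨x, hx, h⟩
    · exact Or.inl (hleast y h)
    · obtain ⟨x, hx', rfl⟩ := (hT x).1 hx
      exact Or.inr ⟨x, hx', hnext x y h⟩

theorem sUnion_eq_toZFSet_iSup {S : ZFSet.{u}} {s : ℕ → Ordinal.{u}}
    (hS : ∀ x, x ∈ S ↔ ∃ n, (s n).toZFSet = x) : S.sUnion = (⨆ n, s n).toZFSet := by
  ext x
  rw [ZFSet.mem_sUnion, Ordinal.mem_toZFSet_iff]
  simp only [hS, Ordinal.lt_iSup_iff]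
  constructor
  · rintro ⟨_, ⟨n, rfl⟩, hx⟩
    obtain ⟨a, ha, rfl⟩ := Ordinal.mem_toZFSet_iff.1 hx
    exact ⟨a, ⟨n, ha⟩, rfl⟩
  · rintro ⟨a, ⟨n, ha⟩, rfl⟩
    exact ⟨_, ⟨n, rfl⟩, Ordinal.toZFSet_mem_toZFSet_iff.2 ha⟩

theorem isOmegaSeq_range {s : ℕ → Ordinal.{u}} (hs : StrictMono s) :
    IsOmegaSeq (ZFSet.range fun n => (s n).toZFSet) := by
  have hmem : ∀ {m n}, (s m).toZFSet ∈ (s n).toZFSet ↔ m < n := by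
    intro m n
    rw [Ordinal.toZFSet_mem_toZFSet_iff, hs.lt_iff_lt]
  have heq : ∀ {m n}, (s m).toZFSet = (s n).toZFSet ↔ m = n := by
    intro m n
    rw [Ordinal.toZFSet_injective.eq_iff, hs.injective.eq_iff]
  have hleast : IsMemLeast (ZFSet.range fun n => (s n).toZFSet) (s 0).toZFSet := by
    simp only [IsMemLeast, ZFSet.mem_range, forall_exists_index, forall_apply_eq_imp_iff, heq, hmem]
    exact ⟨⟨0, rfl⟩, fun n => by omega⟩
  have hnext : ∀ n, IsMemNext (ZFSet.range fun n => (s n).toZFSet) (s n).toZFSet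
      (s (n + 1)).toZFSet := by
    intro n
    simp only [IsMemNext, ZFSet.mem_range, forall_exists_index, forall_apply_eq_imp_iff, heq, hmem]
    exact ⟨⟨⟨n, rfl⟩, ⟨n + 1, rfl⟩, by omega⟩, fun m => by omega⟩
  refine ⟨⟨_, hleast.1, hleast⟩, ?_, ?_⟩
  · intro x hx
    obtain ⟨n, rfl⟩ := ZFSet.mem_range.1 hx
    exact ⟨_, (hnext n).1.2.1, hnext n⟩
  · intro x hx
    obtain ⟨n, rfl⟩ := ZFSet.mem_range.1 hx
    cases n with
    | zero => exact Or.inl hleast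
    | succ n => exact Or.inr ⟨_, (hnext n).1.1, hnext n⟩

end UltrapowerAxiom

namespace UltrapowerAxiom

open Filter

/-! ### The ultrapower by a countably complete ultrafilter -/

namespace Represents

variable {F : Ultrafilter ZFSet.{u}} {M : Set ZFSet.{u}} {c : (ZFSet.{u} → ZFSet.{u}) → ZFSet.{u}}

/-- Łoś's theorem. -/
theorem realize_iff (hc : Represents F M c) {α : Type} {n : ℕ} (φ : setLang.BoundedFormula α n)
    (v : α → ZFSet.{u} → ZFSet.{u}) (xs : Fin n → ZFSet.{u} → ZFSet.{u}) :
    φ.Realize (fun i => (⟨c (v i), hc.mem _⟩ : M)) (fun i => ⟨c (xs i), hc.mem _⟩) ↔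
      ∀ᶠ x in F, φ.Realize (fun i => (⟨v i x, trivial⟩ : V.{u})) fun i => ⟨xs i x, trivial⟩ := by
  -- There are no function symbols, so every term is a variable.
  have hterm : ∀ {n : ℕ} (xs : Fin n → ZFSet.{u} → ZFSet.{u}) (t : setLang.Term (α ⊕ Fin n)),
      ∃ a : ZFSet.{u} → ZFSet.{u},
        (t.realize (Sum.elim (fun i => (⟨c (v i), hc.mem _⟩ : M))
          (fun i => ⟨c (xs i), hc.mem _⟩))).1 = c a ∧
        ∀ x, (t.realize (Sum.elim (fun i => (⟨v i x, trivial⟩ : V.{u}))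
          fun i => ⟨xs i x, trivial⟩)).1 = a x := by
    intro n xs t
    cases t with
    | var i =>
      rcases i with i | i
      · exact ⟨v i, rfl, fun x => rfl⟩
      · exact ⟨xs i, rfl, fun x => rfl⟩
    | func f => exact Empty.elim f
  induction φ with
  | falsum => simp [Language.BoundedFormula.Realize, F.neBot.ne]
  | equal t₁ t₂ =>
    obtain ⟨a, ha, ha'⟩ := hterm xs t₁
    obtain ⟨b, hb, hb'⟩ := hterm xs t₂
    simp only [Language.BoundedFormula.Realize, Subtype.ext_iff, ha, hb, ha', hb', hc.eq_iff]
  | @rel n l r ts =>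
    cases r
    obtain ⟨a, ha, ha'⟩ := hterm xs (ts 0)
    obtain ⟨b, hb, hb'⟩ := hterm xs (ts 1)
    have h := hc.mem_iff a b
    rw [← ha, ← hb] at h
    simp only [← ha', ← hb'] at h
    exact h
  | imp φ ψ ih₁ ih₂ =>
    simp only [Language.BoundedFormula.realize_imp, ih₁, ih₂, Ultrafilter.eventually_imp]
  | all φ ih =>
    have e : ∀ (P : Set ZFSet.{u}) (k : ℕ) (ys : Fin k → P) (y : P) (zs : Fin (k + 1) → P),
        (∀ i : Fin k, zs i.castSucc = ys i) → zs (Fin.last k) = y → Fin.snoc ys y = zs := by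
      intro P k ys y zs h1 h2
      rw [← Fin.snoc_init_self zs, h2]
      congr 1
      exact (funext h1).symm
    simp only [Language.BoundedFormula.realize_all]
    constructor
    · intro h
      by_contra hn
      rw [← Ultrafilter.eventually_not] at hn
      have h1 : ∀ᶠ x in F, ∃ y : ZFSet.{u}, ¬ φ.Realize (fun i => (⟨v i x, trivial⟩ : V.{u}))
          (Fin.snoc (fun i => ⟨xs i x, trivial⟩) ⟨y, trivial⟩) := hn.mono fun x hx => by
        push Not at hx
        obtain ⟨⟨y, _⟩, hy⟩ := hx
        exact ⟨y, hy⟩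
      -- Counterexamples chosen coordinatewise form one function, whose class is a counterexample in
      -- `M`.
      obtain ⟨y, hy⟩ := eventually_exists_iff.1 h1
      have h2 := h ⟨c y, hc.mem y⟩
      rw [e M _ _ _ (fun i => ⟨c ((Fin.snoc xs y : Fin _ → ZFSet.{u} → ZFSet.{u}) i), hc.mem _⟩)
        (fun i => by simp) (by simp)] at h2
      replace h2 := (ih (Fin.snoc xs y)).1 h2
      obtain ⟨x, hx1, hx2⟩ := (h2.and hy).exists
      apply hx2
      rw [e V _ _ _ (fun i => ⟨(Fin.snoc xs y : Fin _ → ZFSet.{u} → ZFSet.{u}) i x, trivial⟩)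
        (fun i => by simp) (by simp)]
      exact hx1
    · rintro h ⟨y, hy⟩
      obtain ⟨y, rfl⟩ := hc.surj y hy
      rw [e M _ _ _ (fun i => ⟨c ((Fin.snoc xs y : Fin _ → ZFSet.{u} → ZFSet.{u}) i), hc.mem _⟩)
        (fun i => by simp) (by simp)]
      refine (ih (Fin.snoc xs y)).2 ?_
      filter_upwards [h] with x hx
      have := hx ⟨y x, trivial⟩
      rwa [e V _ _ _ (fun i => ⟨(Fin.snoc xs y : Fin _ → ZFSet.{u} → ZFSet.{u}) i x, trivial⟩)
        (fun i => by simp) (by simp)] at this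

/-- The elementary embedding of the universe into an ultrapower. -/
noncomputable def embedding (hc : Represents F M c) : V.{u} ↪ₑ[setLang] M where
  toFun x := ⟨c fun _ => x.1, hc.mem _⟩
  map_formula' := by
    intro n φ x
    have h := hc.realize_iff φ (fun i _ => (x i).1) (fun i _ => i.elim0)
    rw [Filter.eventually_const] at h
    convert h using 1
    · rw [Language.Formula.Realize]
      congr! 1
    · rw [Language.Formula.Realize]
      congr! 1

end Represents

/-! ### Well-foundedness and the Mostowski collapse -/

section Collapse

variable (F : Ultrafilter ZFSet.{u})

/-- The membership relation of the ultrapower of the universe by `F`. -/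
def UMem (a b : ZFSet.{u} → ZFSet.{u}) : Prop := ∀ᶠ x in F, a x ∈ b x

/-- Countable completeness makes the countably many relations of a descending chain hold at one
common coordinate, giving a true descending ∈-chain. -/
theorem wellFounded_uMem [CountableInterFilter (F : Filter ZFSet.{u})] :
    WellFounded (UMem F) := by
  rw [wellFounded_iff_isEmpty_descending_chain]
  refine ⟨fun ⟨s, hs⟩ => ?_⟩
  have h : ∀ᶠ x in F, ∀ n, s (n + 1) x ∈ s n x := eventually_countable_forall.2 hs
  obtain ⟨x, hx⟩ := h.exists
  exact (wellFounded_iff_isEmpty_descending_chain.1 ZFSet.mem_wf).false ⟨fun n => s n x, hx⟩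

open Classical in
/-- The set with given elements, if they form a set. -/
noncomputable def setOfSmall (s : Set ZFSet.{u}) : ZFSet.{u} :=
  if _h : Small.{u} s then ZFSet.range (Subtype.val : s → ZFSet.{u}) else ∅

theorem mem_setOfSmall {s : Set ZFSet.{u}} (_ : Small.{u} s) {x : ZFSet.{u}} :
    x ∈ setOfSmall s ↔ x ∈ s := by
  rw [setOfSmall, dif_pos ‹_›]
  simp

variable [CountableInterFilter (F : Filter ZFSet.{u})]

/-- The Mostowski collapse of the ultrapower of the universe by `F`. -/
noncomputable def collapse : (ZFSet.{u} → ZFSet.{u}) → ZFSet.{u} :=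
  (wellFounded_uMem F).fix fun a ih => setOfSmall {y | ∃ d, ∃ h : UMem F d a, ih d h = y}

theorem collapse_eq (a : ZFSet.{u} → ZFSet.{u}) :
    collapse F a = setOfSmall {y | ∃ d, UMem F d a ∧ collapse F d = y} := by
  rw [collapse, WellFounded.fix_eq]
  simp only [exists_prop]

theorem collapse_congr {a b : ZFSet.{u} → ZFSet.{u}} (h : ∀ᶠ x in F, a x = b x) :
    collapse F a = collapse F b := by
  have : ∀ d, UMem F d a ↔ UMem F d b := fun d => by
    refine eventually_congr (h.mono fun x hx => ?_)
    rw [hx]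
  simp only [collapse_eq F a, collapse_eq F b, this]

variable {F}

theorem mem_collapse_iff {X : ZFSet.{u}} (hX : ∀ᶠ x in F, x ∈ X) {a : ZFSet.{u} → ZFSet.{u}}
    {y : ZFSet.{u}} : y ∈ collapse F a ↔ ∃ d, UMem F d a ∧ collapse F d = y := by
  classical
  rw [collapse_eq, mem_setOfSmall]
  · rfl
  -- Set-likeness: modulo `F`, a member of `a` is a choice function on `X` with values in `a x ∪
  -- {∅}`, and these form a set; `∅` is the value at exceptional coordinates.
  let A : X → ZFSet.{u} := fun x => insert ∅ (a x.1)
  let r : ((x : X) → A x) → ZFSet.{u} → ZFSet.{u} :=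
    fun g x => if hx : x ∈ X then (g ⟨x, hx⟩).1 else ∅
  refine small_subset (s := Set.range fun g => collapse F (r g)) ?_
  rintro _ ⟨d, hd, rfl⟩
  refine ⟨fun x => if hx : d x.1 ∈ a x.1 then ⟨d x.1, ZFSet.mem_insert_of_mem _ hx⟩ else
    ⟨∅, ZFSet.mem_insert _ _⟩, collapse_congr F ?_⟩
  filter_upwards [hd, hX] with x h1 h2
  simp [r, h1, h2]

theorem eventually_eq_of_collapse_eq {X : ZFSet.{u}} (hX : ∀ᶠ x in F, x ∈ X)
    {a b : ZFSet.{u} → ZFSet.{u}} (h : collapse F a = collapse F b) : ∀ᶠ x in F, a x = b x := by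
  induction a using (wellFounded_uMem F).induction generalizing b with
  | _ a ih =>
  by_contra hn
  rw [← Ultrafilter.eventually_not] at hn
  have h1 : ∀ᶠ x in F, (∃ y, y ∈ a x ∧ y ∉ b x) ∨ ∃ y, y ∈ b x ∧ y ∉ a x := by
    refine hn.mono fun x hx => ?_
    by_contra h2
    push Not at h2
    exact hx (ZFSet.ext fun z => ⟨h2.1 z, h2.2 z⟩)
  rw [Ultrafilter.eventually_or, eventually_exists_iff, eventually_exists_iff] at h1
  rcases h1 with ⟨d, hd⟩ | ⟨d, hd⟩
  · have h2 : collapse F d ∈ collapse F b :=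
      h ▸ (mem_collapse_iff hX).2 ⟨d, hd.mono fun x hx => hx.1, rfl⟩
    obtain ⟨e, he, hde⟩ := (mem_collapse_iff hX).1 h2
    have h3 := ih d (hd.mono fun x hx => hx.1) hde.symm
    obtain ⟨x, hx⟩ := (h3.and (hd.and he)).exists
    exact hx.2.1.2 (hx.1 ▸ hx.2.2)
  · have h2 : collapse F d ∈ collapse F a :=
      h ▸ (mem_collapse_iff hX).2 ⟨d, hd.mono fun x hx => hx.1, rfl⟩
    obtain ⟨e, he, hde⟩ := (mem_collapse_iff hX).1 h2
    -- The induction is on `a`, so it applies to `e`, the member of `a` with the same collapse as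
    -- `d`.
    have h3 := ih e he hde
    obtain ⟨x, hx⟩ := (h3.and (hd.and he)).exists
    exact hx.2.1.2 (hx.1 ▸ hx.2.2)

theorem represents_collapse {X : ZFSet.{u}} (hX : ∀ᶠ x in F, x ∈ X) :
    Represents F (Set.range (collapse F)) (collapse F) where
  trans := by
    rintro _ ⟨a, rfl⟩ y hy
    obtain ⟨d, -, rfl⟩ := (mem_collapse_iff hX).1 hy
    exact ⟨d, rfl⟩
  mem a := ⟨a, rfl⟩
  surj y hy := hy
  eq_iff a b := ⟨eventually_eq_of_collapse_eq hX, collapse_congr F⟩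
  mem_iff a b := by
    rw [mem_collapse_iff hX]
    constructor
    · rintro ⟨d, hd, h⟩
      filter_upwards [hd, eventually_eq_of_collapse_eq hX h] with x h1 h2 using h2 ▸ h1
    · exact fun h => ⟨a, h, rfl⟩

end Collapse

theorem IsCountablyCompleteUltrafilter.countableInterFilter {X D : ZFSet.{u}}
    (h : IsCountablyCompleteUltrafilter X D) :
    CountableInterFilter (h.1.toUltrafilter : Filter ZFSet.{u}) := by
  refine ⟨fun S hS hmem => ?_⟩
  obtain rfl | hne := S.eq_empty_or_nonempty
  · simp
  obtain ⟨f, rfl⟩ := hS.exists_eq_range hne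
  have h1 := h.2 (fun n => X.sep (· ∈ f n)) fun n => hmem _ ⟨n, rfl⟩
  change X.sep (· ∈ ⋂₀ Set.range f) ∈ D
  convert h1 using 1
  ext x
  simp +contextual

theorem Represents.isUltrapowerBy {M : Set ZFSet.{u}} {X U : ZFSet.{u}} {h : IsUltrafilterOn V X U}
    {c : (ZFSet.{u} → ZFSet.{u}) → ZFSet.{u}} (hc : Represents h.toUltrafilter M c) :
    IsUltrapowerBy V M X U hc.embedding := by
  refine ⟨h, hc.trans, fun f => ⟨c f.apply, hc.mem _⟩, ?_, ?_, ?_, ?_⟩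
  · rintro ⟨y, hy⟩
    obtain ⟨a, rfl⟩ := hc.surj y hy
    refine ⟨FunIn.ofFun X a, Subtype.ext ((hc.eq_iff _ _).2 ?_)⟩
    exact h.eventually_mem.mono fun x hx => FunIn.ofFun_apply a hx
  · intro f g
    rw [Subtype.ext_iff, hc.eq_iff, eqSet_eq, h.eventually_iff]
  · intro f g
    rw [hc.mem_iff, memSet_eq, h.eventually_iff]
  · intro a
    have he : (FunIn.ofFun X fun _ => a.1).1 = X.prod {a.1} := by
      ext z
      simp [FunIn.ofFun, ZFSet.mem_map, ZFSet.mem_prod, eq_comm]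
    refine ⟨_, he, Subtype.ext ((hc.eq_iff _ _).2 ?_)⟩
    exact h.eventually_mem.mono fun x hx => FunIn.ofFun_apply _ hx

theorem IsCountablyCompleteUltrafilter.exists_ultrapower {X D : ZFSet.{u}}
    (h : IsCountablyCompleteUltrafilter X D) :
    ∃ (M : Set ZFSet.{u}) (c : (ZFSet.{u} → ZFSet.{u}) → ZFSet.{u})
      (hc : Represents h.1.toUltrafilter M c), IsUltrapowerEmbedding hc.embedding := by
  have := h.countableInterFilter
  have hc := represents_collapse h.1.eventually_mem
  exact ⟨_, _, hc, X, D, hc.isUltrapowerBy⟩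

end UltrapowerAxiom

namespace UltrapowerAxiom

/-! ### A partition of a successor cardinal into `ω`-stationary sets -/

/-- `C` is unbounded in `μ` and closed under suprema below `μ` of increasing `ω`-sequences. -/
def IsOmegaClub (μ : Ordinal.{u}) (C : Set Ordinal.{u}) : Prop :=
  (∀ b < μ, ∃ a ∈ C, b < a ∧ a < μ) ∧
    ∀ s : ℕ → Ordinal.{u}, StrictMono s → (∀ n, s n ∈ C) → ⨆ n, s n < μ → ⨆ n, s n ∈ C

variable {κ : Cardinal.{u}}

theorem iSup_lt_succ_ord (hκ : ℵ₀ ≤ κ) {ι : Type u} (hι : #ι ≤ κ) {f : ι → Ordinal.{u}}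
    (hf : ∀ i, f i < (Order.succ κ).ord) : ⨆ i, f i < (Order.succ κ).ord :=
  Ordinal.iSup_lt_of_lt_cof (by rwa [(isRegular_succ hκ).cof_ord, Order.lt_succ_iff]) hf

theorem iSup_nat_lt_succ_ord (hκ : ℵ₀ ≤ κ) {f : ℕ → Ordinal.{u}}
    (hf : ∀ i, f i < (Order.succ κ).ord) : ⨆ i, f i < (Order.succ κ).ord := by
  have h := iSup_lt_succ_ord hκ (ι := ULift.{u} ℕ) (by simpa using hκ) (f := fun i => f i.down)
    fun i => hf _
  exact (Equiv.ulift.{u}.symm.iSup_congr (f := f) (g := fun i => f i.down) fun _ => rfl).trans_lt h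

/-- At most `κ` many `ω`-clubs of the successor of `κ` have arbitrarily large common elements. -/
theorem exists_mem_omegaClubs (hκ : ℵ₀ ≤ κ) {ι : Type u} (hι : #ι ≤ κ) {C : ι → Set Ordinal.{u}}
    (hC : ∀ i, IsOmegaClub (Order.succ κ).ord (C i)) {b : Ordinal.{u}}
    (hb : b < (Order.succ κ).ord) :
    ∃ a, b < a ∧ a < (Order.succ κ).ord ∧ ∀ i, a ∈ C i := by
  set μ := (Order.succ κ).ord with hμ
  have hlim : Order.IsSuccLimit μ := isSuccLimit_ord (hκ.trans (Order.le_succ κ))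
  choose! next hn using fun i => (hC i).1
  -- `N a` exceeds `a` and the next point of every club after `a`, and stays below `μ` by
  -- regularity. The orbit of `b` under `N` then interleaves with points of each `C i`, so its
  -- supremum lies in all of them.
  let N : Ordinal.{u} → Ordinal.{u} := fun a => max a (⨆ i, next i a) + 1
  have hN : ∀ a < μ, N a < μ := fun a ha =>
    hlim.add_one_lt (max_lt ha (iSup_lt_succ_ord hκ hι fun i => (hn i a ha).2.2))
  have hN1 : ∀ a, a < N a := fun a => Order.lt_add_one_iff.2 (le_max_left _ _)
  have hN2 : ∀ i a, next i a < N a := fun i a => Order.lt_add_one_iff.2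
    ((Ordinal.le_iSup (fun i => next i a) i).trans (le_max_right _ _))
  have hs : ∀ n, N^[n] b < μ := by
    intro n
    induction n with
    | zero => exact hb
    | succ n ih => rw [Function.iterate_succ_apply']; exact hN _ ih
  have hmono : ∀ n, N^[n] b < N^[n + 1] b := fun n => by
    rw [Function.iterate_succ_apply']; exact hN1 _
  have hsup : ⨆ n, N^[n] b < μ := iSup_nat_lt_succ_ord hκ hs
  refine ⟨⨆ n, N^[n] b, (hmono 0).trans_le (Ordinal.le_iSup (fun n => N^[n] b) 1), hsup, fun i => ?_⟩
  have h1 : ∀ n, N^[n] b < next i (N^[n] b) := fun n => (hn i _ (hs n)).2.1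
  have h2 : ∀ n, next i (N^[n] b) < N^[n + 1] b := fun n => by
    rw [Function.iterate_succ_apply']; exact hN2 i _
  have h3 : ⨆ n, next i (N^[n] b) = ⨆ n, N^[n] b := by
    apply le_antisymm
    · exact Ordinal.iSup_le fun n => (h2 n).le.trans (Ordinal.le_iSup (fun n => N^[n] b) (n + 1))
    · exact Ordinal.iSup_le fun n =>
        (h1 n).le.trans (Ordinal.le_iSup (fun n => next i (N^[n] b)) n)
  rw [← h3]
  refine (hC i).2 _ (strictMono_nat_of_lt_succ fun n => (h2 n).trans (h1 (n + 1)))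
    (fun n => (hn i _ (hs n)).1) ?_
  rwa [h3]

/-- A function on the successor of `κ` that takes every value below `γ` on every `ω`-club. -/
theorem exists_omegaStationary_partition (hκ : ℵ₀ ≤ κ) {γ : Ordinal.{u}} (hγ : γ.card ≤ κ)
    (hγ0 : 0 < γ) :
    ∃ f : Ordinal.{u} → Ordinal.{u}, (∀ t, f t < γ) ∧
      ∀ C, IsOmegaClub (Order.succ κ).ord C →
        ∀ a < γ, ∃ t ∈ C, t < (Order.succ κ).ord ∧ f t = a := by
  classical
  set μ := (Order.succ κ).ord with hμ
  let K : Type u := κ.ord.ToType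
  have hK : #K = κ := by simp [K]
  have : Nonempty K := by
    rw [← mk_ne_zero_iff, hK]
    exact (aleph0_pos.trans_le hκ).ne'
  -- An Ulam matrix: every `a < μ = κ⁺` has at most `κ` predecessors.
  have hg : ∀ a : Ordinal.{u}, ∃ g : Ordinal.{u} → K, a < μ → Set.InjOn g (Set.Iio a) := by
    intro a
    by_cases ha : a < μ
    · have h1 : #a.ToType ≤ #K := by
        rw [hK, mk_toType]
        exact Order.lt_succ_iff.1 (lt_ord.1 ha)
      obtain ⟨e⟩ := Cardinal.le_def _ _ |>.1 h1
      refine ⟨fun b => if hb : b < a then e (Ordinal.ToType.mk ⟨b, hb⟩) else Classical.arbitrary K,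
        fun _ b hb d hd h => ?_⟩
      simp only [Set.mem_Iio] at hb hd
      simp only [hb, hd, dif_pos, e.injective.eq_iff, EmbeddingLike.apply_eq_iff_eq] at h
      exact congrArg Subtype.val h
    · exact ⟨fun _ => Classical.arbitrary K, fun h => absurd h ha⟩
  choose g hg using hg
  have hξ : ∀ b < μ, ∃ ξ : K, ∀ C, IsOmegaClub μ C → ∃ t ∈ C, t < μ ∧ b < t ∧ g t b = ξ := by
    intro b hb
    -- Otherwise each `ξ` has an `ω`-club `C ξ` avoiding it; a common element `t > b` of these `κ`
    -- clubs contradicts the choice `ξ = g t b`.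
    by_contra! hcon
    choose C hC hC' using hcon
    obtain ⟨t, h1, h2, h3⟩ := exists_mem_omegaClubs hκ hK.le hC hb
    exact hC' (g t b) t (h3 _) h2 h1 rfl
  choose! ξ hξ using hξ
  have hcard : #μ.ToType = Order.succ κ := by simp [hμ]
  -- Among `κ⁺` many rows `b` and `κ` many values, one value `ζ` serves more than `κ` rows; `γ` of
  -- these rows are selected by `ι`.
  obtain ⟨ζ, hζ⟩ := infinite_pigeonhole_card_lt
    (fun x : μ.ToType => ξ (Ordinal.ToType.mk.symm x).1)
    (by rw [hcard, hK]; exact Order.lt_succ κ) (by rw [hcard]; exact hκ.trans (Order.le_succ κ))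
  have h1 : #γ.ToType ≤ _ := (mk_toType γ).le.trans ((hγ.trans hK.ge).trans hζ.le)
  obtain ⟨e⟩ := Cardinal.le_def _ _ |>.1 h1
  let ι : Set.Iio γ → Ordinal.{u} := fun a => (Ordinal.ToType.mk.symm (e (Ordinal.ToType.mk a)).1).1
  have hι : Function.Injective ι := fun a b h => by
    exact Ordinal.ToType.mk.injective (e.injective (Subtype.ext
      (Ordinal.ToType.mk.symm.injective (Subtype.ext h))))
  have hι1 : ∀ a, ι a < μ := fun a => (Ordinal.ToType.mk.symm (e (Ordinal.ToType.mk a)).1).2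
  have hι2 : ∀ a, ξ (ι a) = ζ := fun a => (e (Ordinal.ToType.mk a)).2
  refine ⟨fun t => if h : ∃ a, ι a < t ∧ g t (ι a) = ζ then h.choose.1 else 0, fun t => ?_, ?_⟩
  · dsimp only
    split_ifs with h
    · exact h.choose.2
    · exact hγ0
  · intro C hC a ha
    obtain ⟨t, ht, htμ, hat, hgt⟩ := hξ (ι ⟨a, ha⟩) (hι1 _) C hC
    rw [hι2] at hgt
    refine ⟨t, ht, htμ, ?_⟩
    have h : ∃ a, ι a < t ∧ g t (ι a) = ζ := ⟨_, hat, hgt⟩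
    dsimp only
    rw [dif_pos h]
    -- Injectivity of `g t` below `t` makes the selected stationary sets disjoint, so the chosen
    -- index is `a`.
    have h2 := hg t htμ (Set.mem_Iio.2 h.choose_spec.1) (Set.mem_Iio.2 hat)
      (h.choose_spec.2.trans hgt.symm)
    exact congrArg Subtype.val (hι h2)

end UltrapowerAxiom

namespace UltrapowerAxiom

open Filter

attribute [local instance] Classical.allZFSetDefinable

/-! ### Definability of internal ultrapower embeddings -/

namespace Represents

variable {F : Ultrafilter ZFSet.{u}} {P Q : Set ZFSet.{u}}
  {c : (ZFSet.{u} → ZFSet.{u}) → ZFSet.{u}} {i : P ↪ₑ[setLang] Q}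

theorem isFirstOrder_iff (hc : Represents F P c) {R : Set ZFSet.{u} → (ℕ → ZFSet.{u}) → Prop}
    (hR : IsFirstOrder R) (v : ℕ → ZFSet.{u} → ZFSet.{u}) :
    R P (fun n => c (v n)) ↔ ∀ᶠ x in F, R V fun n => v n x := by
  obtain ⟨φ, hφ⟩ := hR
  have h := hc.realize_iff φ v (fun i _ => i.elim0)
  rw [← hφ P hc.trans fun n => ⟨c (v n), hc.mem _⟩]
  convert h using 1
  · rw [Language.Formula.Realize]
    congr! 1
  · refine eventually_congr (Eventually.of_forall fun x => ?_)
    rw [← hφ V (fun _ _ _ _ => trivial) fun n => ⟨v n x, trivial⟩, Language.Formula.Realize]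
    apply iff_of_eq
    congr! 1

/-- An internal ultrapower embedding of `P` has definable preimages of sets. -/
theorem exists_preimage (hc : Represents F P c) (hi : IsInternalUltrapowerEmbedding i)
    {Y : ZFSet.{u}} (hY : Y ∈ P) (y : Q) :
    ∃ T ∈ P, ∀ t : P, t.1 ∈ T ↔ t.1 ∈ Y ∧ (i t).1 ∈ y.1 := by
  obtain ⟨X, W, hW, hU, -, cls, hsurj, -, hmem, hconst⟩ := hi
  obtain ⟨s, rfl⟩ := hsurj y
  -- With `y = [s]_W`, the preimage is `{t ∈ Y : {z ∈ X : t ∈ s(z)} ∈ W}`; the second parameter is a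
  -- dummy.
  refine ⟨_, hc.sep_sep_mem (R := fun s _ z t => ∃ y, ZFSet.pair z y ∈ s ∧ t ∈ y)
    (fun s _ z t => hc.exists_pair_mem_iff s z t) s.2.1 s.2.1 hU.base_mem hW hY, fun t => ?_⟩
  obtain ⟨ct, hct, hct'⟩ := hconst t
  rw [ZFSet.mem_sep, ← hct', hmem, memSet_eq]
  rw [sep_congr (q := fun z => ct.apply z ∈ s.apply z)]
  intro z hz
  simp only [s.pair_mem_iff hz, FunIn.apply_of_eq_prod hct hz, exists_eq_left']

/-- An ultrafilter derived from an internal ultrapower embedding of `P`, pushed forward by a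
relation in `P`, belongs to `P`. -/
theorem exists_derived (hc : Represents F P c) (hi : IsInternalUltrapowerEmbedding i)
    {Y R : ZFSet.{u}} (hY : Y ∈ P) (hR : R ∈ P) (y : Q) :
    ∃ E ∈ P, E ⊆ Y ∧ ∀ A B : P, (∀ b, b ∈ B.1 ↔ ∃ a, ZFSet.pair b a ∈ R ∧ a ∈ A.1) →
      (A.1 ∈ E ↔ A.1 ∈ Y ∧ y.1 ∈ (i B).1) := by
  obtain ⟨X, W, hW, hU, -, cls, hsurj, -, hmem, hconst⟩ := hi
  obtain ⟨g, rfl⟩ := hsurj y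
  -- With `y = [g]_W`, a set `A` is measured by whether `g(z)` is `R`-related to an element of `A`
  -- for `W`-almost all `z`.
  refine ⟨_, hc.sep_sep_mem
    (R := fun g r z t => ∃ y a, ZFSet.pair z y ∈ g ∧ ZFSet.pair y a ∈ r ∧ a ∈ t)
    (fun g r z t => hc.exists_pair_mem_comp_iff g r z t) g.2.1 hR hU.base_mem hW hY,
    ZFSet.sep_subset, fun A B hAB => ?_⟩
  obtain ⟨cB, hcB, hcB'⟩ := hconst B
  rw [ZFSet.mem_sep, ← hcB', hmem, memSet_eq]
  rw [sep_congr (q := fun z => g.apply z ∈ cB.apply z)]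
  intro z hz
  simp only [g.pair_mem_iff hz, FunIn.apply_of_eq_prod hcB hz, hAB]
  exact ⟨fun ⟨y, a, h, h'⟩ => ⟨a, h ▸ h'⟩, fun ⟨a, h⟩ => ⟨_, a, rfl, h⟩⟩

end Represents

/-! ### Closure of pointwise images -/

/-- `C` is closed under unions of its subsets of order type `ω` that belong to `P`. -/
def IsOmegaClosedIn (P : Set ZFSet.{u}) (C : ZFSet.{u}) : Prop :=
  ∀ S ∈ P, S ⊆ C → IsOmegaSeq S → ∀ w ∈ P, w = S.sUnion → w ∈ C

theorem isFirstOrder_isOmegaClosedIn : IsFirstOrder.{u} fun P v => IsOmegaClosedIn P (v 0) := by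
  refine ((((isFirstOrder_subset 1 0).imp ((isFirstOrder_isOmegaSeq 1).imp
    (((isFirstOrder_sUnion 1 2).imp (IsFirstOrder.mem 2 0)).all 2))).all 1)).congr fun P v => ?_
  simp [IsOmegaClosedIn]

/-- The pullback `S'` of `S` also has order type `ω`, so `j(S') = j''S' = S` and `⋃ S = j(⋃ S')`;
regularity of `κ⁺` keeps `⋃ S'` below `κ⁺`. -/
theorem isOmegaClosedIn_image {κ : Cardinal.{u}} (hκ : ℵ₀ ≤ κ) {M : Set ZFSet.{u}}
    (hM : IsTransitiveClass M) (j : V.{u} ↪ₑ[setLang] M) {C : ZFSet.{u}}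
    (hC : ∀ y, y ∈ C ↔ ∃ a < (Order.succ κ).ord, (j ⟨a.toZFSet, trivial⟩).1 = y) :
    IsOmegaClosedIn M C := by
  rintro S - hSC hS w - rfl
  have hV : IsTransitiveClass V.{u} := fun _ _ _ _ => trivial
  set S' : ZFSet.{u} := (Order.succ κ).ord.toZFSet.sep fun x => (j ⟨x, trivial⟩).1 ∈ S
  have hSS' : ∀ y, y ∈ S ↔ ∃ x ∈ S', (j ⟨x, trivial⟩).1 = y := by
    intro y
    constructor
    · intro hy
      obtain ⟨a, ha, rfl⟩ := (hC y).1 (hSC hy)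
      exact ⟨_, ZFSet.mem_sep.2 ⟨Ordinal.toZFSet_mem_toZFSet_iff.2 ha, hy⟩, rfl⟩
    · rintro ⟨x, hx, rfl⟩
      exact (ZFSet.mem_sep.1 hx).2
  have hO : IsOmegaSeq S' := hS.of_image (f := fun x => (j ⟨x, trivial⟩).1)
    (fun x y => map_mem_map_iff j _ _)
    (fun x y => by
      rw [← Subtype.ext_iff, j.injective.eq_iff]
      exact Subtype.ext_iff) hSS'
  have hjS : (j ⟨S', trivial⟩).1 = S := by
    ext y
    constructor
    · intro hy
      obtain ⟨x, hx, rfl⟩ := IsOmegaSeq.exists_of_mem_map hV hM j (S := ⟨S', trivial⟩) hO hy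
      exact (hSS' _).2 ⟨x.1, hx, rfl⟩
    · intro hy
      obtain ⟨x, hx, rfl⟩ := (hSS' y).1 hy
      exact (map_mem_map_iff j _ _).2 hx
  obtain ⟨s, hs⟩ := hO.exists_enum
  have h1 : ∀ n, ∃ a < (Order.succ κ).ord, a.toZFSet = s n := fun n =>
    Ordinal.mem_toZFSet_iff.1 (ZFSet.mem_sep.1 ((hs _).2 ⟨n, rfl⟩)).1
  choose a ha ha' using h1
  rw [hC]
  refine ⟨⨆ n, a n, iSup_nat_lt_succ_ord hκ ha, ?_⟩
  rw [← hjS]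
  apply map_sUnion j hV hM
  exact (sUnion_eq_toZFSet_iSup fun x => by simp only [ha', hs]).symm

/-! ### From ultrapower closure to `ω`-clubs on almost every coordinate -/

section Comparison

variable {F : Ultrafilter ZFSet.{u}} {M₁ N : Set ZFSet.{u}}
  {c : (ZFSet.{u} → ZFSet.{u}) → ZFSet.{u}} {κ : Cardinal.{u}}

/-- A set in the ultrapower that contains the image of every ordinal below the successor of `κ` and
that is closed under unions of subsets of order type `ω` is represented by `ω`-clubs. -/
theorem Represents.eventually_isOmegaClub (hc : Represents F M₁ c) (hκ : ℵ₀ ≤ κ) {γ : Ordinal.{u}}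
    (hγ : γ.card ≤ κ) (hF : ∀ᶠ x in F, x ∈ γ.toZFSet) (T : ZFSet.{u} → ZFSet.{u})
    (hT : ∀ a < (Order.succ κ).ord, (c fun _ => a.toZFSet) ∈ c T)
    (hclosed : ∀ S ∈ M₁, S ⊆ c T → IsOmegaSeq S →
      S.sUnion ∈ (c fun _ => (Order.succ κ).ord.toZFSet) → S.sUnion ∈ c T) :
    ∀ᶠ x in F, IsOmegaClub (Order.succ κ).ord {a | a.toZFSet ∈ T x} := by
  classical
  set μ := (Order.succ κ).ord with hμ
  have hlim : Order.IsSuccLimit μ := isSuccLimit_ord (hκ.trans (Order.le_succ κ))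
  refine Eventually.and ?_ ?_
  · by_contra hn
    rw [← Ultrafilter.eventually_not] at hn
    have h1 : ∀ x, ∃ b < μ, (¬ ∀ b < μ, ∃ a ∈ {a | a.toZFSet ∈ T x}, b < a ∧ a < μ) →
        ∀ a, a.toZFSet ∈ T x → b < a → a < μ → False := by
      intro x
      by_cases h : ∀ b < μ, ∃ a ∈ {a | a.toZFSet ∈ T x}, b < a ∧ a < μ
      · exact ⟨0, hlim.bot_lt, fun h' => absurd h h'⟩
      · push Not at h
        obtain ⟨b, hb, h⟩ := h
        exact ⟨b, hb, fun _ a h1 h2 h3 => (h a h1 h2).not_gt h3⟩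
    choose b hb hb' using h1
    -- If almost every `T x` were bounded, the at most `κ` many bounds would have a supremum `β <
    -- μ`; yet `β + 1` lies in almost every `T x`.
    let β : Ordinal.{u} := ⨆ y : γ.ToType, b (Ordinal.ToType.mk.symm y).1.toZFSet
    have hβ : β < μ := iSup_lt_succ_ord hκ (by rwa [mk_toType]) fun y => hb _
    have h2 := (hc.mem_iff _ _).1 (hT (β + 1) (hlim.add_one_lt hβ))
    obtain ⟨x, hx, hxγ, hxT⟩ := (hn.and (hF.and h2)).exists
    obtain ⟨a, ha, rfl⟩ := Ordinal.mem_toZFSet_iff.1 hxγ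
    refine hb' _ hx (β + 1) hxT ?_ (hlim.add_one_lt hβ)
    rw [Order.lt_add_one_iff]
    have := Ordinal.le_iSup (fun y : γ.ToType => b (Ordinal.ToType.mk.symm y).1.toZFSet)
      (Ordinal.ToType.mk ⟨a, ha⟩)
    simpa using this
  · by_contra hn
    rw [← Ultrafilter.eventually_not] at hn
    have h1 : ∀ x, ∃ s : ℕ → Ordinal.{u}, (¬ ∀ s : ℕ → Ordinal.{u}, StrictMono s →
        (∀ n, s n ∈ {a | a.toZFSet ∈ T x}) → ⨆ n, s n < μ → ⨆ n, s n ∈ {a | a.toZFSet ∈ T x}) →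
        StrictMono s ∧ (∀ n, (s n).toZFSet ∈ T x) ∧ ⨆ n, s n < μ ∧ (⨆ n, s n).toZFSet ∉ T x := by
      intro x
      by_cases h : ∀ s : ℕ → Ordinal.{u}, StrictMono s →
        (∀ n, s n ∈ {a | a.toZFSet ∈ T x}) → ⨆ n, s n < μ → ⨆ n, s n ∈ {a | a.toZFSet ∈ T x}
      · exact ⟨0, fun h' => absurd h h'⟩
      · push Not at h
        obtain ⟨s, h1, h2, h3, h4⟩ := h
        exact ⟨s, fun _ => ⟨h1, h2, h3, h4⟩⟩
    choose s hs using h1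
    -- The coordinatewise failures assemble to one set of order type `ω` in `M₁` violating
    -- `hclosed`.
    let S : ZFSet.{u} → ZFSet.{u} := fun x => ZFSet.range fun n => (s x n).toZFSet
    have hU : (c S).sUnion = c fun x => (⨆ n, s x n).toZFSet := by
      rw [← hc.c_sUnion]
      congr 1
      ext1 x
      exact sUnion_eq_toZFSet_iSup fun y => ZFSet.mem_range
    have h2 := hclosed (c S) (hc.mem S) (hc.subset_iff.2 (hn.mono fun x hx y hy => ?_))
      ((hc.isFirstOrder_iff (isFirstOrder_isOmegaSeq 0) fun _ => S).2 (hn.mono fun x hx =>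
        isOmegaSeq_range (hs x hx).1)) ?_
    · rw [hU, hc.mem_iff] at h2
      obtain ⟨x, hx, hx'⟩ := (hn.and h2).exists
      exact (hs x hx).2.2.2 hx'
    · obtain ⟨n, rfl⟩ := ZFSet.mem_range.1 hy
      exact (hs x hx).2.1 n
    · rw [hU, hc.mem_iff]
      exact hn.mono fun x hx => Ordinal.toZFSet_mem_toZFSet_iff.2 (hs x hx).2.2.1

end Comparison

/-! ### The finite case and the main argument -/

theorem Represents.mem_of_finite_ordinal {F : Ultrafilter ZFSet.{u}} {M : Set ZFSet.{u}}
    {c : (ZFSet.{u} → ZFSet.{u}) → ZFSet.{u}} (hc : Represents F M c) {γ : Ordinal.{u}}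
    (hγ : γ < Ordinal.omega0) {D : ZFSet.{u}} (hD : ∀ A ∈ D, A ⊆ γ.toZFSet)
    (hγM : ∀ x ∈ γ.toZFSet, x ∈ M) : D ∈ M := by
  have h1 : (γ.toZFSet : Set ZFSet.{u}).Finite := by
    obtain ⟨n, rfl⟩ := Ordinal.lt_omega0.1 hγ
    rw [Ordinal.coe_toZFSet, ← Ordinal.natCast_image_Iio]
    exact ((Set.finite_Iio n).image _).image _
  refine hc.mem_of_finite ?_ fun A hA =>
    hc.mem_of_finite (h1.subset (hD A hA)) fun x hx => hγM x (hD A hA hx)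
  refine Set.Finite.of_finite_image (f := fun A : ZFSet.{u} => (A : Set ZFSet.{u}))
    (h1.finite_subsets.subset ?_) SetLike.coe_injective.injOn
  rintro _ ⟨A, hA, rfl⟩
  exact hD A hA

/-- Under the Ultrapower Axiom, an ultrapower of the universe that is closed under `λ`-sequences
contains all countably complete ultrafilters on ordinals below `λ`. -/
theorem IsCountablyCompleteUltrafilter.mem_of_powSubset (hUA : UA.{u}) {lam : Cardinal.{u}}
    {M : Set ZFSet.{u}} (hM : IsUltrapowerOfV M) (hpow : PowSubset M lam.ord.toZFSet)
    {γ : Ordinal.{u}} (hγ : γ < lam.ord) {D : ZFSet.{u}}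
    (hD : IsCountablyCompleteUltrafilter γ.toZFSet D) : D ∈ M := by
  obtain ⟨j, X, U, hU⟩ := hM
  obtain ⟨c, hc, -⟩ := hU.exists_represents
  have hordM : ∀ a ≤ lam.ord, a.toZFSet ∈ M := fun a ha => hc.toZFSet_mem hpow ha
  rcases lt_or_ge γ Ordinal.omega0 with hfin | hinf
  · exact hc.mem_of_finite_ordinal hfin (fun A hA => (hD.1.mem_and_subset A hA).2)
      fun x hx => hc.trans _ (hordM γ hγ.le) _ hx
  set κ := γ.card
  have hκ : ℵ₀ ≤ κ := by
    simpa only [Ordinal.card_omega0] using Ordinal.card_le_card hinf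
  set μ := (Order.succ κ).ord with hμ
  -- Since `|γ| < λ`, its successor is at most `λ`, so `M` contains pointwise images of subsets of
  -- `μ`.
  have hμlam : μ ≤ lam.ord := ord_le_ord.2 (Order.succ_le_of_lt (lt_ord.1 hγ))
  have hμsub : μ.toZFSet ⊆ lam.ord.toZFSet := Ordinal.toZFSet_subset_toZFSet_iff.2 hμlam
  have hγsub : γ.toZFSet ⊆ lam.ord.toZFSet := Ordinal.toZFSet_subset_toZFSet_iff.2 hγ.le
  obtain ⟨f, hfγ, hf⟩ := exists_omegaStationary_partition hκ (γ := γ) le_rfl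
    (Ordinal.omega0_pos.trans_le hinf)
  obtain ⟨M₁, c₁, hc₁, hk⟩ := hD.exists_ultrapower
  obtain ⟨N, i, h, hN, ⟨hcomm, hh⟩, -, hi⟩ := hUA M M₁ j hc₁.embedding ⟨X, U, hU⟩ hk
  have hcF : ∀ᶠ x in hD.1.toUltrafilter, x ∈ γ.toZFSet := hD.1.eventually_mem
  let jj : ZFSet.{u} → ZFSet.{u} := fun x => (j ⟨x, trivial⟩).1
  have hjj : ∀ x, jj x ∈ M := fun x => (j _).2
  -- the pointwise image of `μ`
  let C : M := ⟨ZFSet.image jj μ.toZFSet, hc.image_mem hpow hμsub _ fun x _ => hjj x⟩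
  have hC : ∀ y, y ∈ C.1 ↔ ∃ a < μ, (j ⟨a.toZFSet, trivial⟩).1 = y := by
    intro y
    rw [ZFSet.mem_image]
    constructor
    · rintro ⟨x, hx, rfl⟩
      obtain ⟨a, ha, rfl⟩ := Ordinal.mem_toZFSet_iff.1 hx
      exact ⟨a, ha, rfl⟩
    · rintro ⟨a, ha, rfl⟩
      exact ⟨_, Ordinal.toZFSet_mem_toZFSet_iff.2 ha, rfl⟩
  have hiC : IsOmegaClosedIn N (i C).1 :=
    (isFirstOrder_isOmegaClosedIn.map_iff hc.trans hN i fun _ => C).2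
      (isOmegaClosedIn_image hκ hc.trans j hC)
  -- its preimage in the ultrapower by `D`
  obtain ⟨T, hTM, hT⟩ := hc₁.exists_preimage hh (hc₁.mem fun _ => μ.toZFSet) (i C)
  obtain ⟨T, rfl⟩ := hc₁.surj T hTM
  have hclub := hc₁.eventually_isOmegaClub hκ le_rfl hcF T
    (fun a ha => by
      refine (hT ⟨_, hc₁.mem _⟩).2 ⟨(hc₁.mem_iff _ _).2 (Eventually.of_forall fun x =>
        Ordinal.toZFSet_mem_toZFSet_iff.2 ha), ?_⟩
      have := hcomm ⟨a.toZFSet, trivial⟩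
      change (h (hc₁.embedding ⟨a.toZFSet, trivial⟩)).1 ∈ _
      rw [← this, map_mem_map_iff]
      exact (hC _).2 ⟨a, ha, rfl⟩)
    (fun S hS hST hSO hSμ => by
      obtain ⟨S, rfl⟩ := hc₁.surj S hS
      have hw : (c₁ S).sUnion ∈ M₁ := hc₁.c_sUnion S ▸ hc₁.mem _
      refine (hT ⟨_, hw⟩).2 ⟨hSμ, ?_⟩
      -- `h(S)` has order type `ω`, hence equals `h''S`, which lies inside `i(C)`.
      refine hiC (h ⟨c₁ S, hS⟩).1 (h _).2 ?_
        (((isFirstOrder_isOmegaSeq 0).map_iff hc₁.trans hN h fun _ => ⟨c₁ S, hS⟩).2 hSO) _ (h _).2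
        (map_sUnion h hc₁.trans hN rfl)
      intro y hy
      obtain ⟨x, hx, rfl⟩ :=
        IsOmegaSeq.exists_of_mem_map hc₁.trans hN h (S := ⟨c₁ S, hS⟩) hSO hy
      exact ((hT x).1 (hST hx)).2)
  have ht : ∀ᶠ x in hD.1.toUltrafilter, ∃ y, y ∈ T x ∧ ∃ a < μ, a.toZFSet = y ∧
      (f a).toZFSet = x := by
    filter_upwards [hclub, hcF] with x hx hxγ
    obtain ⟨b, hb, rfl⟩ := Ordinal.mem_toZFSet_iff.1 hxγ
    obtain ⟨a, haT, ha, hab⟩ := hf _ hx b hb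
    exact ⟨_, haT, a, ha, rfl, by rw [hab]⟩
  obtain ⟨t, ht⟩ := eventually_exists_iff.1 ht
  let τ : M₁ := ⟨c₁ t, hc₁.mem t⟩
  have hτC : (h τ).1 ∈ (i C).1 :=
    ((hT τ).1 ((hc₁.mem_iff _ _).2 (ht.mono fun x hx => hx.1))).2
  -- the pushforward relation
  let ff : ZFSet.{u} → ZFSet.{u} := fun x => (f x.rank).toZFSet
  obtain ⟨rr, hrr⟩ : ∃ rr : ZFSet.{u} → ZFSet.{u}, ∀ x, rr x = ZFSet.pair (jj x) (ff x) :=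
    ⟨_, fun _ => rfl⟩
  have hRM : ZFSet.image rr μ.toZFSet ∈ M :=
    hc.image_mem hpow hμsub _ fun x _ => hrr x ▸ hc.pair_mem (hjj x) (hordM (f x.rank) ((hfγ _).trans hγ).le)
  obtain ⟨E, hEM, hEY, hE⟩ := hc.exists_derived hi
    (hc.powerset_mem hpow hγsub (hordM γ hγ.le)) hRM (h τ)
  have key : ∀ A ⊆ γ.toZFSet, (A ∈ E ↔ A ∈ D) := by
    intro A hA
    have hAM : A ∈ M := hc.mem_of_subset hpow (fun x hx => hγsub (hA hx)) fun x hx =>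
      hc.trans _ (hordM γ hγ.le) _ (hA hx)
    let A' : ZFSet.{u} := μ.toZFSet.sep fun x => ff x ∈ A
    let B : M := ⟨ZFSet.image jj A', hc.image_mem hpow
      (fun x hx => hμsub (ZFSet.mem_sep.1 hx).1) _ fun x _ => hjj x⟩
    have hB : ∀ y, y ∈ B.1 ↔ ∃ x ∈ A', jj x = y := fun y => by simp only [B, ZFSet.mem_image]
    have hBR : ∀ b, b ∈ B.1 ↔ ∃ a, ZFSet.pair b a ∈
        ZFSet.image rr μ.toZFSet ∧ a ∈ A := by
      intro b
      simp only [hB, A', hrr, ZFSet.mem_image, ZFSet.mem_sep, ZFSet.pair_inj]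
      constructor
      · rintro ⟨x, ⟨hx, hxA⟩, rfl⟩
        exact ⟨_, ⟨x, hx, rfl, rfl⟩, hxA⟩
      · rintro ⟨_, ⟨x, hx, rfl, rfl⟩, hxA⟩
        exact ⟨x, ⟨hx, hxA⟩, rfl⟩
    have h1 : A ∈ D ↔ (c₁ t) ∈ c₁ fun _ => A' := by
      rw [← hD.1.eventually_mem_iff hA, hc₁.mem_iff]
      refine eventually_congr (ht.mono fun x hx => ?_)
      obtain ⟨-, a, ha, hat, hax⟩ := hx
      simp only [A', ZFSet.mem_sep, ← hat, ff, Ordinal.rank_toZFSet, hax,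
        Ordinal.toZFSet_mem_toZFSet_iff, ha, true_and]
    have h2 : (c₁ t) ∈ (c₁ fun _ => A') ↔ (h τ).1 ∈ (i (j ⟨A', trivial⟩)).1 := by
      rw [hcomm, map_mem_map_iff]
      rfl
    -- `j(A')` need not be usable inside `M` uniformly in `A`, but `B = j(A') ∩ C` is, and `h(τ) ∈
    -- i(C)` makes the two interchangeable.
    have h3 : (h τ).1 ∈ (i (j ⟨A', trivial⟩)).1 ↔ (h τ).1 ∈ (i B).1 := by
      constructor
      · intro hx
        refine map_inter_subset i hc.trans hN (x := C) (y := j ⟨A', trivial⟩) ?_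
          (ZFSet.mem_inter.2 ⟨hτC, hx⟩)
        intro y hy
        obtain ⟨hy1, hy2⟩ := ZFSet.mem_inter.1 hy
        obtain ⟨a, ha, rfl⟩ := (hC y).1 hy1
        exact (hB _).2 ⟨_, (map_mem_map_iff j _ _).1 hy2, rfl⟩
      · intro hx
        refine map_subset_map i hc.trans hN (x := B) (y := j ⟨A', trivial⟩) ?_ hx
        intro y hy
        obtain ⟨x, hx, rfl⟩ := (hB y).1 hy
        exact (map_mem_map_iff j _ _).2 hx
    rw [hE ⟨A, hAM⟩ B hBR, h1, h2, h3]
    exact and_iff_right (ZFSet.mem_powerset.2 hA)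
  have hED : E = D := by
    ext A
    constructor
    · intro h1
      have h2 := ZFSet.mem_powerset.1 (hEY h1)
      exact (key A h2).1 h1
    · intro h1
      exact (key A (hD.1.mem_and_subset A h1).2).2 h1
  exact hED ▸ hEM

end UltrapowerAxiom

theorem mainTheorem5 (hUA : UltrapowerAxiom.UA.{u})
    (lam : Cardinal.{u}) (hlam : ℵ₀ ≤ lam)
    (M : Set ZFSet.{u}) (hM : UltrapowerAxiom.IsUltrapowerOfV M)
    (hpow : UltrapowerAxiom.PowSubset M lam.ord.toZFSet)
    (γ : Ordinal.{u}) (hγ : γ < lam.ord) (D : ZFSet.{u})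
    (hD : UltrapowerAxiom.IsCountablyCompleteUltrafilter γ.toZFSet D) :
    D ∈ M :=
  hD.mem_of_powSubset hUA hM hpow hγ
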